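/- Let $R$ be a commutative ring, $I_R$ a minimal injective cogenerator for $\mathrm{Mod}\,R$ and $D=\mathrm{Hom}_R(-,I_R)$. An $R$-module $M$ is *reflexive* if the canonical map $M\to D^2M$, $x\mapsto (f\mapsto f(x))$, is bijective. Let $\mathcal A$ be a triangulated $R$-category and let $\mathcal C$ be a tri-exact $R$-category, that is, a full subcategory of $\mathcal A$ that contains the zero object and is extension-closed: if $X\to Y\to Z\to X[1]$ is an exact triangle in $\mathcal A$ with $X,Z\in\mathcal C$, then $Y\in\mathcal C$. Write $\mathrm{Ext}^1_{\mathcal C}(X,Y)=\mathrm{Hom}_{\mathcal A}(X,Y[1])$. A morphism $f$ of $\mathcal C$ is *injectively trivial* (respectively *projectively trivial*) if $\mathrm{Ext}^1_{\mathcal C}(M,f)=0$ (respectively $\mathrm{Ext}^1_{\mathcal C}(f,M)=0$) for all $M\in\mathcal C$; an object is *Ext-injective* (respectively *Ext-projective*) if its identity is injectively (respectively projectively) trivial. Let $\overline{\mathcal C}$ and $\underline{\mathcal C}$ be the quotients of $\mathcal C$ by the ideals of injectively and of projectively trivial morphisms, with morphism modules $\overline{\mathrm{Hom}}_{\mathcal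 C}$ and $\underline{\mathrm{Hom}}_{\mathcal C}$. An *almost split sequence* in $\mathcal C$ is a sequence $X\xrightarrow{f}Y\xrightarrow{g}Z$ in $\mathcal C$ that embeds in an exact triangle $X\to Y\to Z\to X[1]$ of $\mathcal A$, such that $f$ is minimal left almost split and $g$ is minimal right almost split in $\mathcal C$. An object is *strongly indecomposable* if its endomorphism ring is local. One says that $\mathcal C$ *has almost split sequences on the right* (respectively *left*) if every strongly indecomposable object that is not Ext-projective (respectively not Ext-injective) is the ending (respectively starting) term of an almost split sequence, and that $\mathcal C$ *has almost split sequences* if both hold. A *right Auslander–Reiten functor* for $\mathcal C$ is an additive functor $\tau:\underline{\mathcal C}\to\overline{\mathcal C}$ for which there are $R$-linear isomorphisms $\underline{\mathrm{Hom}}_{\mathcal C}(X,Y)\to D\,\mathrm{Ext}^1_{\mathcal C}(Y,\tau X)$, natural in $X$ and in $Y$. A *left Auslander–Reiten functor* for $\mathcal C$ is an additive functor $\tau^-:\overline{\mathcal C}\to\underline{\mathcal C}$ for which there are $R$-linear isomorphisms $\overline{\mathrm{Hom}}_{\mathcal C}(X,Y)\to D\,\mathrm{Ext}^1_{\mathcal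 C}(\tau^-Y,X)$, natural in $X$ and in $Y$. Such a functor is called a right (respectively left) *Auslander–Reiten equivalence* if it is an equivalence of categories. **Theorem.** Assume that $\mathrm{Hom}_{\mathcal C}(X,Y)$ is a reflexive $R$-module for all $X,Y\in\mathcal C$ (that is, $\mathcal C$ is Hom-reflexive) and that $\mathcal C$ is Krull–Schmidt, that is, every non-zero object of $\mathcal C$ is a finite direct sum of strongly indecomposable objects of $\mathcal C$. 1. $\mathcal C$ has almost split sequences on the right (respectively, left) if and only if it admits a full right (respectively, left) Auslander–Reiten functor. 2. $\mathcal C$ has almost split sequences if and only if it admits a right Auslander–Reiten equivalence, or equivalently, a left Auslander–Reiten equivalence; and in this case $\mathcal C$ is Ext-reflexive, that is, $\mathrm{Ext}^1_{\mathcal C}(X,Y)$ is a reflexive $R$-module for all $X,Y\in\mathcal C$. -/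

import Mathlib

open CategoryTheory CategoryTheory.Limits CategoryTheory.Pretriangulated

universe w v u

namespace TriExact

section Modules

/-- `I` is an injective cogenerator for `Mod R`: it is injective, and the linear maps to `I`
separate the points of every `R`-module. -/
structure IsInjectiveCogenerator (R : Type w) [CommRing R] (I : Type w) [AddCommGroup I]
    [Module R I] : Prop where
  injective : Module.Injective R I
  separates : ∀ (M : Type w) [AddCommGroup M] [Module R M] (x : M), x ≠ 0 →
    ∃ f : M →ₗ[R] I, f x ≠ 0

/-- `I` is a minimal injective cogenerator for `Mod R`: an injective cogenerator that embeds in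
(equivalently, as `I` is injective, is isomorphic to a direct summand of) every injective
cogenerator. It is unique up to isomorphism. -/
structure IsMinimalInjectiveCogenerator (R : Type w) [CommRing R] (I : Type w) [AddCommGroup I]
    [Module R I] : Prop extends IsInjectiveCogenerator R I where
  minimal : ∀ (J : Type w) [AddCommGroup J] [Module R J], IsInjectiveCogenerator R J →
    ∃ f : I →ₗ[R] J, Function.Injective f

/-- `M` is reflexive with respect to `D = Hom_R(-, I)`: the evaluation map `M → D (D M)`,
`x ↦ (f ↦ f x)`, is bijective. -/
def IsReflexive (R : Type w) [CommRing R] (I : Type w) [AddCommGroup I] [Module R I]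
    (M : Type v) [AddCommGroup M] [Module R M] : Prop :=
  Function.Bijective fun x : M => (LinearMap.applyₗ x : (M →ₗ[R] I) →ₗ[R] I)

end Modules

section Morphisms

variable {C : Type u} [Category.{v} C]

/-- Every endomorphism `h` of `Y` with `h ∘ f = f` is an automorphism. -/
def IsLeftMinimal {X Y : C} (f : X ⟶ Y) : Prop :=
  ∀ h : Y ⟶ Y, f ≫ h = f → IsIso h

/-- Every endomorphism `h` of `X` with `f ∘ h = f` is an automorphism. -/
def IsRightMinimal {X Y : C} (f : X ⟶ Y) : Prop :=
  ∀ h : X ⟶ X, h ≫ f = f → IsIso h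

/-- `f` is not a section, and every non-section starting at `X` factors through `f`. -/
def IsLeftAlmostSplit {X Y : C} (f : X ⟶ Y) : Prop :=
  ¬ IsSplitMono f ∧ ∀ (M : C) (g : X ⟶ M), ¬ IsSplitMono g → ∃ h : Y ⟶ M, f ≫ h = g

/-- `f` is not a retraction, and every non-retraction ending at `Y` factors through `f`. -/
def IsRightAlmostSplit {X Y : C} (f : X ⟶ Y) : Prop :=
  ¬ IsSplitEpi f ∧ ∀ (M : C) (g : M ⟶ Y), ¬ IsSplitEpi g → ∃ h : M ⟶ X, h ≫ f = g

/-- `X` has a local endomorphism ring. -/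
def IsStronglyIndecomposable [Preadditive C] (X : C) : Prop :=
  IsLocalRing (End X)

/-- Every non-zero object is a finite direct sum of strongly indecomposable objects. -/
def IsKrullSchmidt (C : Type u) [Category.{v} C] [Preadditive C] : Prop :=
  ∀ X : C, ¬ IsZero X → ∃ (n : ℕ) (F : Fin n → C) (b : Bicone F),
    (∀ i, IsStronglyIndecomposable (F i)) ∧ Nonempty b.IsBilimit ∧ Nonempty (X ≅ b.pt)

end Morphisms

section TriExactCategories

variable {A : Type u} [Category.{v} A] [HasZeroObject A] [HasShift A ℤ] [Preadditive A]
  [∀ n : ℤ, (shiftFunctor A n).Additive] [Pretriangulated A]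

/-- The full subcategory of objects satisfying `P` is an extension-closed subcategory of the
triangulated category `A`, i.e. a tri-exact category. Since it contains a zero object, it is
closed under isomorphisms and finite direct sums. -/
class IsExtensionClosed (P : ObjectProperty A) : Prop extends P.ContainsZero where
  ext_closed : ∀ T ∈ distTriang A, P T.obj₁ → P T.obj₃ → P T.obj₂

variable (P : ObjectProperty A)

variable {P} in
/-- `Ext¹(X, Y) = Hom_A(X, Y[1])`. -/
abbrev Ext1 (X Y : P.FullSubcategory) : Type v := X.obj ⟶ Y.obj⟦(1 : ℤ)⟧

variable {P} in
/-- `δ · f = δ ∘ f`. -/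
def Ext1.pre {X' X Y : P.FullSubcategory} (f : X' ⟶ X) (δ : Ext1 X Y) : Ext1 X' Y :=
  f.hom ≫ δ

variable {P} in
/-- `g · δ = g[1] ∘ δ`. -/
def Ext1.post {X Y Y' : P.FullSubcategory} (g : Y ⟶ Y') (δ : Ext1 X Y) : Ext1 X Y' :=
  δ ≫ g.hom⟦(1 : ℤ)⟧'

/-- `X ⟶ Y ⟶ Z` embeds in an exact triangle of `A`. -/
def IsTriExactSequence {X Y Z : P.FullSubcategory} (f : X ⟶ Y) (g : Y ⟶ Z) : Prop :=
  ∃ δ : Ext1 Z X, Triangle.mk f.hom g.hom δ ∈ distTriang A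

/-- A tri-exact sequence whose first map is minimal left almost split and whose second map is
minimal right almost split. -/
def IsAlmostSplitSequence {X Y Z : P.FullSubcategory} (f : X ⟶ Y) (g : Y ⟶ Z) : Prop :=
  IsTriExactSequence P f g ∧ (IsLeftMinimal f ∧ IsLeftAlmostSplit f) ∧
    (IsRightMinimal g ∧ IsRightAlmostSplit g)

/-- `Ext¹(M, f) = 0` for all `M`. -/
def IsInjectivelyTrivial {X Y : P.FullSubcategory} (f : X ⟶ Y) : Prop :=
  ∀ (M : P.FullSubcategory) (δ : Ext1 M X), Ext1.post f δ = 0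

/-- `Ext¹(f, M) = 0` for all `M`. -/
def IsProjectivelyTrivial {X Y : P.FullSubcategory} (f : X ⟶ Y) : Prop :=
  ∀ (M : P.FullSubcategory) (δ : Ext1 Y M), Ext1.pre f δ = 0

def IsExtInjective (X : P.FullSubcategory) : Prop := IsInjectivelyTrivial P (𝟙 X)

def IsExtProjective (X : P.FullSubcategory) : Prop := IsProjectivelyTrivial P (𝟙 X)

/-- Every strongly indecomposable, not Ext-projective object is the ending term of an almost
split sequence. -/
def HasAlmostSplitSequencesOnTheRight : Prop :=
  ∀ Z : P.FullSubcategory, IsStronglyIndecomposable Z → ¬ IsExtProjective P Z →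
    ∃ (X Y : P.FullSubcategory) (f : X ⟶ Y) (g : Y ⟶ Z), IsAlmostSplitSequence P f g

/-- Every strongly indecomposable, not Ext-injective object is the starting term of an almost
split sequence. -/
def HasAlmostSplitSequencesOnTheLeft : Prop :=
  ∀ X : P.FullSubcategory, IsStronglyIndecomposable X → ¬ IsExtInjective P X →
    ∃ (Y Z : P.FullSubcategory) (f : X ⟶ Y) (g : Y ⟶ Z), IsAlmostSplitSequence P f g

def HasAlmostSplitSequences : Prop :=
  HasAlmostSplitSequencesOnTheRight P ∧ HasAlmostSplitSequencesOnTheLeft P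

/-! ### The stable categories -/

/-- Congruence modulo the ideal of injectively trivial morphisms. -/
def injRel : HomRel P.FullSubcategory := fun _ _ f g => IsInjectivelyTrivial P (f - g)

/-- Congruence modulo the ideal of projectively trivial morphisms. -/
def projRel : HomRel P.FullSubcategory := fun _ _ f g => IsProjectivelyTrivial P (f - g)

lemma injRel_iff {X Y : P.FullSubcategory} (f g : X ⟶ Y) :
    injRel P f g ↔ ∀ (M : P.FullSubcategory) (δ : Ext1 M X), Ext1.post f δ = Ext1.post g δ := by
  refine forall₂_congr fun M δ => ?_
  have h : (f - g).hom = f.hom - g.hom := rfl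
  simp only [Ext1.post, h, Functor.map_sub, Preadditive.comp_sub, sub_eq_zero]

lemma projRel_iff {X Y : P.FullSubcategory} (f g : X ⟶ Y) :
    projRel P f g ↔ ∀ (M : P.FullSubcategory) (δ : Ext1 Y M), Ext1.pre f δ = Ext1.pre g δ := by
  refine forall₂_congr fun M δ => ?_
  have h : (f - g).hom = f.hom - g.hom := rfl
  simp only [Ext1.pre, h, Preadditive.sub_comp, sub_eq_zero]

instance : Congruence (injRel P) where
  equivalence :=
    { refl := fun f => by simp [injRel_iff]
      symm := fun h => by
        rw [injRel_iff] at h ⊢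
        exact fun M δ => (h M δ).symm
      trans := fun h h' => by
        rw [injRel_iff] at h h' ⊢
        exact fun M δ => (h M δ).trans (h' M δ) }
  comp_left f _ _ h := by
    rw [injRel_iff] at h ⊢
    intro M δ
    simpa [Ext1.post] using h M (Ext1.post f δ)
  comp_right f h := by
    rw [injRel_iff] at h ⊢
    intro M δ
    simpa [Ext1.post] using congrArg (Ext1.post f) (h M δ)

instance : Congruence (projRel P) where
  equivalence :=
    { refl := fun f => by simp [projRel_iff]
      symm := fun h => by
        rw [projRel_iff] at h ⊢
        exact fun M δ => (h M δ).symm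
      trans := fun h h' => by
        rw [projRel_iff] at h h' ⊢
        exact fun M δ => (h M δ).trans (h' M δ) }
  comp_left f _ _ h := by
    rw [projRel_iff] at h ⊢
    intro M δ
    simpa [Ext1.pre] using congrArg (Ext1.pre f) (h M δ)
  comp_right f h := by
    rw [projRel_iff] at h ⊢
    intro M δ
    simpa [Ext1.pre] using h M (Ext1.pre f δ)

/-- The injectively stable category. -/
abbrev InjStable := Quotient (injRel P)

/-- The projectively stable category. -/
abbrev ProjStable := Quotient (projRel P)

lemma injRel_add ⦃X Y : P.FullSubcategory⦄ (f₁ f₂ g₁ g₂ : X ⟶ Y) (hf : injRel P f₁ f₂)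
    (hg : injRel P g₁ g₂) : injRel P (f₁ + g₁) (f₂ + g₂) := by
  rw [injRel_iff] at *
  intro M δ
  have h (a b : X ⟶ Y) : Ext1.post (a + b) δ = Ext1.post a δ + Ext1.post b δ := by
    have h' : (a + b).hom = a.hom + b.hom := rfl
    simp [Ext1.post, h', Functor.map_add]
  rw [h, h, hf, hg]

lemma projRel_add ⦃X Y : P.FullSubcategory⦄ (f₁ f₂ g₁ g₂ : X ⟶ Y) (hf : projRel P f₁ f₂)
    (hg : projRel P g₁ g₂) : projRel P (f₁ + g₁) (f₂ + g₂) := by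
  rw [projRel_iff] at *
  intro M δ
  have h (a b : X ⟶ Y) : Ext1.pre (a + b) δ = Ext1.pre a δ + Ext1.pre b δ := by
    have h' : (a + b).hom = a.hom + b.hom := rfl
    simp [Ext1.pre, h']
  rw [h, h, hf, hg]

instance : Preadditive (InjStable P) := Quotient.preadditive _ (injRel_add P)

instance : Preadditive (ProjStable P) := Quotient.preadditive _ (projRel_add P)

instance : (Quotient.functor (injRel P)).Additive := Quotient.functor_additive _ (injRel_add P)

instance : (Quotient.functor (projRel P)).Additive := Quotient.functor_additive _ (projRel_add P)

variable {P} in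
/-- The action `ḡ · δ = g · δ` of morphisms of the injectively stable category on `Ext¹`. -/
def Ext1.stablePost {X : P.FullSubcategory} {Y Y' : InjStable P} (g : Y ⟶ Y')
    (δ : Ext1 X Y.as) : Ext1 X Y'.as :=
  Quot.liftOn g (fun a => Ext1.post a δ) fun a b h => by
    rw [HomRel.compClosure_iff_self, injRel_iff] at h
    exact h X δ

variable {P} in
/-- The action `δ · f̲ = δ · f` of morphisms of the projectively stable category on `Ext¹`. -/
def Ext1.stablePre {X' X : ProjStable P} {Y : P.FullSubcategory} (f : X' ⟶ X)
    (δ : Ext1 X.as Y) : Ext1 X'.as Y :=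
  Quot.liftOn f (fun a => Ext1.pre a δ) fun a b h => by
    rw [HomRel.compClosure_iff_self, projRel_iff] at h
    exact h Y δ

/-! ### The `R`-linear setting -/

variable (R : Type w) [CommRing R] [Linear R A] [∀ n : ℤ, (shiftFunctor A n).Linear R]


lemma injRel_smul (a : R) ⦃X Y : P.FullSubcategory⦄ (f₁ f₂ : X ⟶ Y) (h : injRel P f₁ f₂) :
    injRel P (a • f₁) (a • f₂) := by
  rw [injRel_iff] at *
  intro M δ
  have h' (b : X ⟶ Y) : Ext1.post (a • b) δ = a • Ext1.post b δ := by
    have h' : (a • b).hom = a • b.hom := rfl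
    simp [Ext1.post, h', Functor.map_smul]
  rw [h', h', h]

lemma projRel_smul (a : R) ⦃X Y : P.FullSubcategory⦄ (f₁ f₂ : X ⟶ Y) (h : projRel P f₁ f₂) :
    projRel P (a • f₁) (a • f₂) := by
  rw [projRel_iff] at *
  intro M δ
  have h' (b : X ⟶ Y) : Ext1.pre (a • b) δ = a • Ext1.pre b δ := by
    have h' : (a • b).hom = a • b.hom := rfl
    simp [Ext1.pre, h']
  rw [h', h', h]

instance : Linear R (InjStable P) := Quotient.linear R _ (injRel_smul P R)

instance : Linear R (ProjStable P) := Quotient.linear R _ (projRel_smul P R)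

variable (I : Type w) [AddCommGroup I] [Module R I]

/-- `Hom(X, Y)` is a reflexive `R`-module for all objects `X`, `Y` of the subcategory. -/
def IsHomReflexive : Prop := ∀ X Y : P.FullSubcategory, IsReflexive R I (X ⟶ Y)

/-- `Ext¹(X, Y)` is a reflexive `R`-module for all objects `X`, `Y` of the subcategory. -/
def IsExtReflexive : Prop := ∀ X Y : P.FullSubcategory, IsReflexive R I (Ext1 X Y)

/-- An additive functor `τ` from the projectively to the injectively stable category, for which
there are `R`-linear isomorphisms `Θ X Y` from the projectively stable `Hom(X, Y)` to
`D Ext¹(Y, τ X)`, natural in `X` and in `Y`. -/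
def IsRightAuslanderReitenFunctor (τ : ProjStable P ⥤ InjStable P) : Prop :=
  τ.Additive ∧
  ∃ Θ : ∀ X Y : ProjStable P, (X ⟶ Y) ≃ₗ[R] (Ext1 Y.as (τ.obj X).as →ₗ[R] I),
    (∀ (X' X Y : ProjStable P) (u : X' ⟶ X) (f : X ⟶ Y) (δ : Ext1 Y.as (τ.obj X').as),
      Θ X' Y (u ≫ f) δ = Θ X Y f (Ext1.stablePost (τ.map u) δ)) ∧
    (∀ (X Y Y' : ProjStable P) (f : X ⟶ Y) (v : Y ⟶ Y') (δ : Ext1 Y'.as (τ.obj X).as),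
      Θ X Y' (f ≫ v) δ = Θ X Y f (Ext1.stablePre v δ))

/-- An additive functor `τ` from the injectively to the projectively stable category, for which
there are `R`-linear isomorphisms `Ω X Y` from the injectively stable `Hom(X, Y)` to
`D Ext¹(τ Y, X)`, natural in `X` and in `Y`. -/
def IsLeftAuslanderReitenFunctor (τ : InjStable P ⥤ ProjStable P) : Prop :=
  τ.Additive ∧
  ∃ Ω : ∀ X Y : InjStable P, (X ⟶ Y) ≃ₗ[R] (Ext1 (τ.obj Y).as X.as →ₗ[R] I),
    (∀ (X' X Y : InjStable P) (u : X' ⟶ X) (f : X ⟶ Y) (δ : Ext1 (τ.obj Y).as X'.as),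
      Ω X' Y (u ≫ f) δ = Ω X Y f (Ext1.stablePost u δ)) ∧
    (∀ (X Y Y' : InjStable P) (f : X ⟶ Y) (v : Y ⟶ Y') (δ : Ext1 (τ.obj Y').as X.as),
      Ω X Y' (f ≫ v) δ = Ω X Y f (Ext1.stablePre (τ.map v) δ))

end TriExactCategories

end TriExact

/-!
The proof rests on one symmetric notion. A functional `φ` on `Ext¹(Z, X)` is an *Auslander–Reiten
duality* between `Z` and `X` (`IsARDuality`) if the pairings `(f, ε) ↦ φ (ε · f)` of the
projectively stable `Hom(Z, Y)` with `Ext¹(Y, X)` and `(g, ε) ↦ φ (g · ε)` of the injectively stable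
`Hom(W, X)` with `Ext¹(Z, W)` are non-degenerate. A quotient of a reflexive module is
reflexive, so the stable morphism modules of a Hom-reflexive category are reflexive. Hence these
pairings are perfect (`bijective_of_nondegenerate`), and `Ext¹(Y, X)` is reflexive as well
(`IsARDuality.isReflexive_ext1`).

*From almost split sequences to functors.* The class `δ` of an almost split sequence is almost
vanishing: every non-zero extension ending at `Z` has `δ` as a pushout, and every non-zero extension
starting at `X` has `δ` as a pullback. Hence any functional with `φ δ ≠ 0` is a duality
(`IsARDuality.of_almostVanishing`). Dualities add up over finite direct sums (`IsARDuality.sum`), so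
by the Krull–Schmidt property almost split sequences on the right give every `Z` a dual object
`τ Z`, and those on the left give every `X` a dual object. Two dualities `(Z, X)` and `(Z', X')`
identify the projectively stable `Hom(Z, Z')` and the injectively stable `Hom(X, X')` with
`D Ext¹(Z', X)` (`IsARDuality.homEquiv`). This makes `τ` a fully faithful functor, which is
essentially surjective if every `X` also has a dual object, as dual objects are unique.

*From functors to almost split sequences.* Let `Z` be strongly indecomposable and not
Ext-projective. The dual of `Ext¹(Z, τ Z)` is the stable endomorphism ring of `Z`. By reflexivity a
functional on that ring which kills the radical, but not the identity, is the evaluation at some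
`δ` in `Ext¹(Z, τ Z)`, whose pullbacks along non-retractions vanish
(`exists_isRightAlmostVanishing`). Some component of `δ` at a strongly indecomposable summand of
`τ Z` is non-zero, and its triangle is almost split (`exists_isAlmostSplitSequence`).

Finally, the inverse of a right Auslander–Reiten equivalence is a left one and conversely. The point
is that Auslander–Reiten functors, which are only assumed to be additive, are `R`-linear if they are
full.
-/

namespace TriExact

/-! ### Reflexive modules -/

section Reflexivity

variable {R : Type w} [CommRing R] {I : Type w} [AddCommGroup I] [Module R I]

/-- Linear maps to an injective cogenerator separate the points of modules in any universe, as it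
suffices to do so for cyclic modules. -/
lemma IsInjectiveCogenerator.exists_apply_ne_zero (hI : IsInjectiveCogenerator R I)
    {M : Type*} [AddCommGroup M] [Module R M] {x : M} (hx : x ≠ 0) :
    ∃ f : M →ₗ[R] I, f x ≠ 0 := by
  let p := LinearMap.toSpanSingleton R M x
  let e := p.quotKerEquivRange
  have h1 : (Submodule.Quotient.mk 1 : R ⧸ LinearMap.ker p) ≠ 0 := by
    rw [Ne, Submodule.Quotient.mk_eq_zero, LinearMap.mem_ker]
    simpa [p] using hx
  obtain ⟨g, hg⟩ := hI.separates _ _ h1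
  have := hI.injective
  obtain ⟨h, hh⟩ := Module.Injective.extension_property R I _ _
    (LinearMap.range p).subtype (Submodule.subtype_injective _) (g ∘ₗ e.symm.toLinearMap)
  refine ⟨h, ?_⟩
  have hx' : x = (LinearMap.range p).subtype (e (Submodule.Quotient.mk 1)) := by
    change x = p 1
    simp [p]
  have h2 := LinearMap.congr_fun hh (e (Submodule.Quotient.mk 1))
  rw [LinearMap.comp_apply, ← hx'] at h2
  rw [h2]
  simpa using hg

lemma IsInjectiveCogenerator.eq_zero_of_forall (hI : IsInjectiveCogenerator R I)
    {M : Type*} [AddCommGroup M] [Module R M] {x : M} (h : ∀ f : M →ₗ[R] I, f x = 0) : x = 0 := by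
  by_contra hx
  obtain ⟨f, hf⟩ := hI.exists_apply_ne_zero hx
  exact hf (h f)

/-- A proper submodule is contained in the kernel of a non-zero functional. -/
lemma IsInjectiveCogenerator.exists_le_ker (hI : IsInjectiveCogenerator R I)
    {M : Type*} [AddCommGroup M] [Module R M] (N : Submodule R M) {x : M} (hx : x ∉ N) :
    ∃ f : M →ₗ[R] I, f x ≠ 0 ∧ ∀ y ∈ N, f y = 0 := by
  have h : N.mkQ x ≠ 0 := by simpa using hx
  obtain ⟨f, hf⟩ := hI.exists_apply_ne_zero h
  refine ⟨f ∘ₗ N.mkQ, hf, fun y hy => ?_⟩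
  rw [LinearMap.comp_apply, Submodule.mkQ_apply, (Submodule.Quotient.mk_eq_zero N).2 hy, map_zero]

lemma IsReflexive.of_surjective (hI : IsInjectiveCogenerator R I)
    {M N : Type*} [AddCommGroup M] [Module R M] [AddCommGroup N] [Module R N]
    (hM : IsReflexive R I M) (q : M →ₗ[R] N) (hq : Function.Surjective q) :
    IsReflexive R I N := by
  constructor
  · intro x y hxy
    rw [← sub_eq_zero]
    refine hI.eq_zero_of_forall fun f => ?_
    rw [map_sub, sub_eq_zero]
    exact LinearMap.congr_fun hxy f
  · intro Λ
    have := hI.injective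
    obtain ⟨Λ', hΛ'⟩ := Module.Injective.extension_property R I _ _ (LinearMap.lcomp R I q)
      (fun f g h => LinearMap.cancel_right hq |>.1 h) Λ
    obtain ⟨m, hm⟩ := hM.2 Λ'
    refine ⟨q m, LinearMap.ext fun f => ?_⟩
    rw [← hΛ', ← hm]
    rfl

variable {M N : Type*} [AddCommGroup M] [Module R M] [AddCommGroup N] [Module R N]

/-- If a pairing `b : M × N → I` is non-degenerate and `M` is reflexive, then `N ≅ D M`. -/
lemma bijective_flip_of_nondegenerate (hI : IsInjectiveCogenerator R I) (hM : IsReflexive R I M)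
    (b : M →ₗ[R] N →ₗ[R] I) (h₁ : ∀ m, (∀ n, b m n = 0) → m = 0)
    (h₂ : ∀ n, (∀ m, b m n = 0) → n = 0) : Function.Bijective b.flip := by
  constructor
  · rw [injective_iff_map_eq_zero]
    exact fun n hn => h₂ n fun m => LinearMap.congr_fun hn m
  · by_contra hs
    obtain ⟨ψ, hψ⟩ : ∃ ψ, ψ ∉ LinearMap.range b.flip := by
      by_contra! h
      exact hs h
    obtain ⟨Λ, hΛ, hΛ'⟩ := hI.exists_le_ker _ hψ
    obtain ⟨m, rfl⟩ := hM.2 Λ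
    have hm : m = 0 := h₁ m fun n => hΛ' _ ⟨n, rfl⟩
    exact hΛ (by simp [hm])

/-- If a pairing `b : M × N → I` is non-degenerate and `M` is reflexive, then `M ≅ D N`. -/
lemma bijective_of_nondegenerate (hI : IsInjectiveCogenerator R I) (hM : IsReflexive R I M)
    (b : M →ₗ[R] N →ₗ[R] I) (h₁ : ∀ m, (∀ n, b m n = 0) → m = 0)
    (h₂ : ∀ n, (∀ m, b m n = 0) → n = 0) : Function.Bijective b := by
  constructor
  · rw [injective_iff_map_eq_zero]
    exact fun m hm => h₁ m fun n => LinearMap.congr_fun hm n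
  · intro ψ
    let e := LinearEquiv.ofBijective _ (bijective_flip_of_nondegenerate hI hM b h₁ h₂)
    obtain ⟨m, hm⟩ := hM.2 (ψ ∘ₗ e.symm.toLinearMap)
    refine ⟨m, LinearMap.ext fun n => ?_⟩
    have := LinearMap.congr_fun hm (e n)
    simpa [e] using this

/-- If a pairing `b : M × N → I` is non-degenerate and `M` is reflexive, then so is `N`. -/
lemma IsReflexive.of_nondegenerate (hI : IsInjectiveCogenerator R I) (hM : IsReflexive R I M)
    (b : M →ₗ[R] N →ₗ[R] I) (h₁ : ∀ m, (∀ n, b m n = 0) → m = 0)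
    (h₂ : ∀ n, (∀ m, b m n = 0) → n = 0) : IsReflexive R I N := by
  have hb := bijective_flip_of_nondegenerate hI hM b h₁ h₂
  have hb' := bijective_of_nondegenerate hI hM b h₁ h₂
  constructor
  · intro x y hxy
    refine hb.1 (LinearMap.ext fun m => ?_)
    exact LinearMap.congr_fun hxy (b m)
  · intro Λ
    obtain ⟨n, hn⟩ := hb.2 (Λ ∘ₗ b)
    refine ⟨n, LinearMap.ext fun f => ?_⟩
    obtain ⟨m, rfl⟩ := hb'.2 f
    exact LinearMap.congr_fun hn m

end Reflexivity

/-! ### Calculus of extensions -/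

section Calculus

variable {A : Type u} [Category.{v} A] [HasShift A ℤ] {P : ObjectProperty A}

namespace Ext1

variable {X X' X'' Y Y' Y'' : P.FullSubcategory}

@[simp] lemma pre_id (δ : Ext1 X Y) : pre (𝟙 X) δ = δ := by simp [pre]

lemma pre_comp (f : X'' ⟶ X') (g : X' ⟶ X) (δ : Ext1 X Y) :
    pre (f ≫ g) δ = pre f (pre g δ) := by simp [pre]

@[simp] lemma post_id (δ : Ext1 X Y) : post (𝟙 Y) δ = δ := by simp [post]

lemma post_comp (f : Y ⟶ Y') (g : Y' ⟶ Y'') (δ : Ext1 X Y) :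
    post (f ≫ g) δ = post g (post f δ) := by simp [post]

lemma post_pre (f : X' ⟶ X) (g : Y ⟶ Y') (δ : Ext1 X Y) :
    post g (pre f δ) = pre f (post g δ) := by simp [pre, post]

variable [Preadditive A]

@[simp] lemma pre_add (f : X' ⟶ X) (δ δ' : Ext1 X Y) :
    pre f (δ + δ') = pre f δ + pre f δ' := by simp [pre]

@[simp] lemma pre_zero (f : X' ⟶ X) : pre f (0 : Ext1 X Y) = 0 := by simp [pre]

@[simp] lemma add_pre (f g : X' ⟶ X) (δ : Ext1 X Y) : pre (f + g) δ = pre f δ + pre g δ :=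
  Preadditive.add_comp _ _ _ f.hom g.hom δ

@[simp] lemma sub_pre (f g : X' ⟶ X) (δ : Ext1 X Y) : pre (f - g) δ = pre f δ - pre g δ :=
  Preadditive.sub_comp f.hom g.hom δ

@[simp] lemma zero_pre (δ : Ext1 X Y) : pre (0 : X' ⟶ X) δ = 0 :=
  zero_comp (C := A)

lemma sum_pre {ι : Type*} (s : Finset ι) (f : ι → (X' ⟶ X)) (δ : Ext1 X Y) :
    pre (∑ i ∈ s, f i) δ = ∑ i ∈ s, pre (f i) δ :=
  map_sum (AddMonoidHom.mk' (fun f => pre f δ) fun f g => add_pre f g δ) f s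

@[simp] lemma post_add (f : Y ⟶ Y') (δ δ' : Ext1 X Y) :
    post f (δ + δ') = post f δ + post f δ' := by simp [post]

@[simp] lemma post_zero (f : Y ⟶ Y') : post f (0 : Ext1 X Y) = 0 := by simp [post]

lemma eq_zero_of_isIso_pre {δ : Ext1 X Y} (f : X' ⟶ X) [IsIso f]
    (h0 : pre f δ = 0) : δ = 0 := by
  rw [← pre_id δ, ← IsIso.inv_hom_id f, pre_comp, h0, pre_zero]

lemma eq_zero_of_isIso_post {δ : Ext1 X Y} (f : Y ⟶ Y') [IsIso f]
    (h0 : post f δ = 0) : δ = 0 := by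
  rw [← post_id δ, ← IsIso.hom_inv_id f, post_comp, h0, post_zero]

variable [∀ n : ℤ, (shiftFunctor A n).Additive]

@[simp] lemma add_post (f g : Y ⟶ Y') (δ : Ext1 X Y) :
    post (f + g) δ = post f δ + post g δ := by
  have h : (f + g).hom = f.hom + g.hom := rfl
  simp [post, h, Functor.map_add]

@[simp] lemma zero_post (δ : Ext1 X Y) : post (0 : Y ⟶ Y') δ = 0 := by
  simp [post]

@[simp] lemma sub_post (f g : Y ⟶ Y') (δ : Ext1 X Y) :
    post (f - g) δ = post f δ - post g δ := by
  have h : (f - g).hom = f.hom - g.hom := rfl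
  simp [post, h, Functor.map_sub]

lemma sum_post {ι : Type*} (s : Finset ι) (f : ι → (Y ⟶ Y')) (δ : Ext1 X Y) :
    post (∑ i ∈ s, f i) δ = ∑ i ∈ s, post (f i) δ :=
  map_sum (AddMonoidHom.mk' (fun f => post f δ) fun f g => add_post f g δ) f s

end Ext1

section Local

variable {C : Type*} [Category* C] [Preadditive C]

lemma isIso_or_isIso_sub {X : C} (hX : IsStronglyIndecomposable X) (a : X ⟶ X) :
    IsIso a ∨ IsIso (𝟙 X - a) := by
  have : IsLocalRing (End X) := hX
  have h := IsLocalRing.isUnit_or_isUnit_of_add_one (R := End X) (a := a) (b := 𝟙 X - a)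
    (add_sub_cancel a (𝟙 X))
  rwa [isUnit_iff_isIso, isUnit_iff_isIso] at h

end Local

variable [Preadditive A]

lemma isIso_of_pre_eq {X Z : P.FullSubcategory} (hZ : IsStronglyIndecomposable Z) {δ : Ext1 Z X}
    (hδ : δ ≠ 0) (k : Z ⟶ Z) (hk : Ext1.pre k δ = δ) : IsIso k :=
  (isIso_or_isIso_sub hZ k).resolve_right fun _ =>
    hδ (Ext1.eq_zero_of_isIso_pre (𝟙 Z - k) (by simp [hk]))

variable [∀ n : ℤ, (shiftFunctor A n).Additive]

lemma isIso_of_post_eq {X Z : P.FullSubcategory} (hX : IsStronglyIndecomposable X) {δ : Ext1 Z X}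
    (hδ : δ ≠ 0) (k : X ⟶ X) (hk : Ext1.post k δ = δ) : IsIso k :=
  (isIso_or_isIso_sub hX k).resolve_right fun _ =>
    hδ (Ext1.eq_zero_of_isIso_post (𝟙 X - k) (by simp [hk]))

end Calculus

/-! ### Almost vanishing extensions -/

section Triangles

variable {A : Type u} [Category.{v} A] [HasZeroObject A] [HasShift A ℤ] [Preadditive A]
  [∀ n : ℤ, (shiftFunctor A n).Additive] [Pretriangulated A] {P : ObjectProperty A}

section

variable {X Y Z : P.FullSubcategory} {f : X ⟶ Y} {g : Y ⟶ Z} {δ : Ext1 Z X}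

lemma exists_triangle [IsExtensionClosed P] {X Z : P.FullSubcategory} (δ : Ext1 Z X) :
    ∃ (Y : P.FullSubcategory) (f : X ⟶ Y) (g : Y ⟶ Z),
      Triangle.mk f.hom g.hom δ ∈ distTriang A := by
  obtain ⟨Y, f, g, h⟩ := distinguished_cocone_triangle₂ δ
  exact ⟨⟨Y, IsExtensionClosed.ext_closed _ h X.property Z.property⟩,
    ObjectProperty.homMk f, ObjectProperty.homMk g, h⟩

variable (hT : Triangle.mk f.hom g.hom δ ∈ distTriang A)

include hT

lemma pre_eq_zero_iff {M : P.FullSubcategory} (h : M ⟶ Z) :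
    Ext1.pre h δ = 0 ↔ ∃ k : M ⟶ Y, k ≫ g = h := by
  constructor
  · intro h0
    obtain ⟨k, hk⟩ := Triangle.coyoneda_exact₃ _ hT h.hom h0
    exact ⟨ObjectProperty.homMk k, ObjectProperty.hom_ext _ hk.symm⟩
  · rintro ⟨k, rfl⟩
    have h0 : g.hom ≫ δ = 0 := comp_distTriang_mor_zero₂₃ _ hT
    simp [Ext1.pre, h0]

lemma post_eq_zero_iff {M : P.FullSubcategory} (h : X ⟶ M) :
    Ext1.post h δ = 0 ↔ ∃ k : Y ⟶ M, f ≫ k = h := by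
  constructor
  · intro h0
    obtain ⟨k, hk⟩ := Triangle.yoneda_exact₃ _ (rot_of_distTriang _ hT) (h.hom⟦(1 : ℤ)⟧') h0
    obtain ⟨(k : Y.obj ⟶ M.obj), rfl⟩ := (shiftFunctor A (1 : ℤ)).map_surjective k
    refine ⟨ObjectProperty.homMk (-k), ObjectProperty.hom_ext _
      ((shiftFunctor A (1 : ℤ)).map_injective ?_)⟩
    have hk' : h.hom⟦(1 : ℤ)⟧' = (-f.hom⟦(1 : ℤ)⟧') ≫ k⟦(1 : ℤ)⟧' := hk
    simp [hk']
  · rintro ⟨k, rfl⟩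
    have h0 : δ ≫ f.hom⟦(1 : ℤ)⟧' = 0 := comp_distTriang_mor_zero₃₁ _ hT
    simp [Ext1.post, reassoc_of% h0]

lemma isSplitEpi_iff : IsSplitEpi g ↔ δ = 0 := by
  have h := pre_eq_zero_iff hT (𝟙 Z)
  rw [Ext1.pre_id] at h
  rw [h]
  exact ⟨fun h => ⟨section_ g, by simp⟩, fun ⟨k, hk⟩ => ⟨⟨k, hk⟩⟩⟩

lemma isSplitMono_iff : IsSplitMono f ↔ δ = 0 := by
  have h := post_eq_zero_iff hT (𝟙 X)
  rw [Ext1.post_id] at h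
  rw [h]
  exact ⟨fun h => ⟨retraction f, by simp⟩, fun ⟨k, hk⟩ => ⟨⟨k, hk⟩⟩⟩

end

/-- A non-zero extension `δ` whose pullback along every non-retraction vanishes. -/
def IsRightAlmostVanishing {Z X : P.FullSubcategory} (δ : Ext1 Z X) : Prop :=
  δ ≠ 0 ∧ ∀ (M : P.FullSubcategory) (h : M ⟶ Z), ¬ IsSplitEpi h → Ext1.pre h δ = 0

/-- A non-zero extension `δ` whose pushout along every non-section vanishes. -/
def IsLeftAlmostVanishing {Z X : P.FullSubcategory} (δ : Ext1 Z X) : Prop :=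
  δ ≠ 0 ∧ ∀ (M : P.FullSubcategory) (h : X ⟶ M), ¬ IsSplitMono h → Ext1.post h δ = 0

variable [IsExtensionClosed P]

/-- A right almost vanishing extension is a pushout of every non-zero extension with the same
end: it vanishes on the second map of a triangle of `ε`. -/
lemma IsRightAlmostVanishing.exists_post {Z X M : P.FullSubcategory} {δ : Ext1 Z X}
    (hδ : IsRightAlmostVanishing δ) {ε : Ext1 Z M} (hε : ε ≠ 0) :
    ∃ u : M ⟶ X, Ext1.post u ε = δ := by
  obtain ⟨Y, f, g, hT⟩ := exists_triangle ε
  have h := hδ.2 _ g fun hg => hε ((isSplitEpi_iff hT).1 hg)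
  obtain ⟨k, hk⟩ := Triangle.yoneda_exact₃ _ hT δ h
  obtain ⟨u, rfl⟩ := (shiftFunctor A (1 : ℤ)).map_surjective k
  exact ⟨ObjectProperty.homMk u, hk.symm⟩

/-- A left almost vanishing extension is a pullback of every non-zero extension with the same
start. -/
lemma IsLeftAlmostVanishing.exists_pre {Z X M : P.FullSubcategory} {δ : Ext1 Z X}
    (hδ : IsLeftAlmostVanishing δ) {ε : Ext1 M X} (hε : ε ≠ 0) :
    ∃ u : Z ⟶ M, Ext1.pre u ε = δ := by
  obtain ⟨Y, f, g, hT⟩ := exists_triangle ε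
  have h := hδ.2 _ f fun hf => hε ((isSplitMono_iff hT).1 hf)
  obtain ⟨u, hu⟩ := Triangle.coyoneda_exact₁ _ hT δ h
  exact ⟨ObjectProperty.homMk u, hu.symm⟩

lemma IsRightAlmostVanishing.isLeftAlmostVanishing {X Z : P.FullSubcategory}
    (hX : IsStronglyIndecomposable X) {δ : Ext1 Z X} (hδ : IsRightAlmostVanishing δ) :
    IsLeftAlmostVanishing δ := by
  refine ⟨hδ.1, fun M h hh => ?_⟩
  by_contra h0
  -- otherwise `δ` is recovered from its pushout along `h`, so that `h` is a section
  obtain ⟨u, hu⟩ := hδ.exists_post h0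
  rw [← Ext1.post_comp] at hu
  have := isIso_of_post_eq hX hδ.1 _ hu
  exact hh ⟨⟨u ≫ inv (h ≫ u), by rw [← Category.assoc, IsIso.hom_inv_id]⟩⟩

lemma IsLeftAlmostVanishing.isRightAlmostVanishing {X Z : P.FullSubcategory}
    (hZ : IsStronglyIndecomposable Z) {δ : Ext1 Z X} (hδ : IsLeftAlmostVanishing δ) :
    IsRightAlmostVanishing δ := by
  refine ⟨hδ.1, fun M h hh => ?_⟩
  by_contra h0
  obtain ⟨u, hu⟩ := hδ.exists_pre h0
  rw [← Ext1.pre_comp] at hu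
  have := isIso_of_pre_eq hZ hδ.1 _ hu
  exact hh ⟨⟨inv (u ≫ h) ≫ u, by rw [Category.assoc, IsIso.inv_hom_id]⟩⟩

/-- The middle terms of the triangle of an almost vanishing extension between strongly
indecomposable objects form an almost split sequence. Minimality follows from the five lemma, as
the third component of an endomorphism of the triangle fixes `δ`. -/
lemma exists_isAlmostSplitSequence {X Z : P.FullSubcategory} (hX : IsStronglyIndecomposable X)
    (hZ : IsStronglyIndecomposable Z) {δ : Ext1 Z X} (hr : IsRightAlmostVanishing δ)
    (hl : IsLeftAlmostVanishing δ) :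
    ∃ (Y : P.FullSubcategory) (f : X ⟶ Y) (g : Y ⟶ Z), IsAlmostSplitSequence P f g := by
  obtain ⟨Y, f, g, hT⟩ := exists_triangle δ
  refine ⟨Y, f, g, ⟨δ, hT⟩, ⟨fun h hh => ?_, ?_, ?_⟩, ⟨fun h hh => ?_, ?_, ?_⟩⟩
  · have hh' : f.hom ≫ h.hom = 𝟙 X.obj ≫ f.hom := by simpa using congrArg (·.hom) hh
    obtain ⟨(c : Z.obj ⟶ Z.obj), hc₁, hc₂⟩ :=
      complete_distinguished_triangle_morphism _ _ hT hT (𝟙 X.obj) h.hom hh'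
    have hc : IsIso (ObjectProperty.homMk c : Z ⟶ Z) := by
      refine isIso_of_pre_eq hZ hr.1 _ ?_
      have hc₂' : δ ≫ (𝟙 X.obj)⟦(1 : ℤ)⟧' = c ≫ δ := hc₂
      rw [CategoryTheory.Functor.map_id, Category.comp_id] at hc₂'
      exact hc₂'.symm
    rw [← ObjectProperty.isIso_hom_iff] at hc ⊢
    let φ : Triangle.mk f.hom g.hom δ ⟶ Triangle.mk f.hom g.hom δ :=
      Triangle.homMk _ _ (𝟙 X.obj) h.hom c hh' hc₁ hc₂
    exact isIso₂_of_isIso₁₃ φ hT hT (inferInstanceAs (IsIso (𝟙 X.obj))) hc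
  · rw [isSplitMono_iff hT]
    exact hl.1
  · exact fun M k hk => (post_eq_zero_iff hT k).1 (hl.2 M k hk)
  · have hh' : g.hom ≫ 𝟙 Z.obj = h.hom ≫ g.hom := by simpa using (congrArg (·.hom) hh).symm
    obtain ⟨(c : X.obj ⟶ X.obj), hc₁, hc₂⟩ :=
      complete_distinguished_triangle_morphism₁ _ _ hT hT h.hom (𝟙 Z.obj) hh'
    have hc : IsIso (ObjectProperty.homMk c : X ⟶ X) := by
      refine isIso_of_post_eq hX hr.1 _ ?_
      have hc₂' : δ ≫ c⟦(1 : ℤ)⟧' = 𝟙 Z.obj ≫ δ := hc₂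
      rwa [Category.id_comp] at hc₂'
    rw [← ObjectProperty.isIso_hom_iff] at hc ⊢
    let φ : Triangle.mk f.hom g.hom δ ⟶ Triangle.mk f.hom g.hom δ :=
      Triangle.homMk _ _ c h.hom (𝟙 Z.obj) hc₁ hh' hc₂
    exact isIso₂_of_isIso₁₃ φ hT hT hc (inferInstanceAs (IsIso (𝟙 Z.obj)))
  · rw [isSplitEpi_iff hT]
    exact hl.1
  · exact fun M k hk => (pre_eq_zero_iff hT k).1 (hr.2 M k hk)

omit [IsExtensionClosed P] in
lemma IsAlmostSplitSequence.exists_almostVanishing {X Y Z : P.FullSubcategory} {f : X ⟶ Y}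
    {g : Y ⟶ Z} (h : IsAlmostSplitSequence P f g) :
    ∃ δ : Ext1 Z X, IsRightAlmostVanishing δ ∧ IsLeftAlmostVanishing δ := by
  obtain ⟨⟨δ, hT⟩, ⟨-, hf, hf'⟩, ⟨-, hg, hg'⟩⟩ := h
  have hδ : δ ≠ 0 := fun h0 => hf ((isSplitMono_iff hT).2 h0)
  exact ⟨δ, ⟨hδ, fun M h hh => (pre_eq_zero_iff hT h).2 (hg' M h hh)⟩,
    ⟨hδ, fun M h hh => (post_eq_zero_iff hT h).2 (hf' M h hh)⟩⟩

end Triangles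

/-! ### Morphisms of the stable categories -/

section Stable

variable {A : Type u} [Category.{v} A] [HasZeroObject A] [HasShift A ℤ] [Preadditive A]
  [∀ n : ℤ, (shiftFunctor A n).Additive] [Pretriangulated A] {P : ObjectProperty A}

/-- The class of a morphism in the projectively stable category. -/
abbrev projMk {X Y : P.FullSubcategory} (f : X ⟶ Y) : (⟨X⟩ : ProjStable P) ⟶ ⟨Y⟩ :=
  (Quotient.functor (projRel P)).map f

/-- The class of a morphism in the injectively stable category. -/
abbrev injMk {X Y : P.FullSubcategory} (f : X ⟶ Y) : (⟨X⟩ : InjStable P) ⟶ ⟨Y⟩ :=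
  (Quotient.functor (injRel P)).map f

omit [HasZeroObject A] [∀ n : ℤ, (shiftFunctor A n).Additive] [Pretriangulated A] in
lemma projMk_surjective {X Y : ProjStable P} (f : X ⟶ Y) :
    ∃ g : X.as ⟶ Y.as, projMk g = f :=
  (Quotient.functor (projRel P)).map_surjective (X := X.as) (Y := Y.as) f

omit [HasZeroObject A] [∀ n : ℤ, (shiftFunctor A n).Additive] [Pretriangulated A] in
lemma injMk_surjective {X Y : InjStable P} (f : X ⟶ Y) :
    ∃ g : X.as ⟶ Y.as, injMk g = f :=
  (Quotient.functor (injRel P)).map_surjective (X := X.as) (Y := Y.as) f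

lemma projMk_eq_zero_iff {X Y : P.FullSubcategory} (f : X ⟶ Y) :
    projMk f = 0 ↔ IsProjectivelyTrivial P f := by
  rw [← (Quotient.functor (projRel P)).map_zero, Quotient.functor_map_eq_iff, projRel, sub_zero]

lemma injMk_eq_zero_iff {X Y : P.FullSubcategory} (f : X ⟶ Y) :
    injMk f = 0 ↔ IsInjectivelyTrivial P f := by
  rw [← (Quotient.functor (injRel P)).map_zero, Quotient.functor_map_eq_iff, injRel, sub_zero]

namespace Ext1

@[simp] lemma stablePre_projMk {X' X Y : P.FullSubcategory} (f : X' ⟶ X) (δ : Ext1 X Y) :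
    stablePre (projMk f) δ = pre f δ := rfl

@[simp] lemma stablePost_injMk {X Y Y' : P.FullSubcategory} (f : Y ⟶ Y') (δ : Ext1 X Y) :
    stablePost (injMk f) δ = post f δ := rfl

lemma stablePre_comp {X'' X' X : ProjStable P} {Y : P.FullSubcategory} (f : X'' ⟶ X')
    (g : X' ⟶ X) (δ : Ext1 X.as Y) : stablePre (f ≫ g) δ = stablePre f (stablePre g δ) := by
  obtain ⟨f, rfl⟩ := projMk_surjective f
  obtain ⟨g, rfl⟩ := projMk_surjective g
  exact pre_comp f g δ

@[simp] lemma stablePre_id {X : ProjStable P} {Y : P.FullSubcategory} (δ : Ext1 X.as Y) :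
    stablePre (𝟙 X) δ = δ := pre_id δ

lemma stablePost_comp {Y Y' Y'' : InjStable P} {X : P.FullSubcategory} (f : Y ⟶ Y')
    (g : Y' ⟶ Y'') (δ : Ext1 X Y.as) :
    stablePost (f ≫ g) δ = stablePost g (stablePost f δ) := by
  obtain ⟨f, rfl⟩ := injMk_surjective f
  obtain ⟨g, rfl⟩ := injMk_surjective g
  exact post_comp f g δ

@[simp] lemma stablePost_id {Y : InjStable P} {X : P.FullSubcategory} (δ : Ext1 X Y.as) :
    stablePost (𝟙 Y) δ = δ := post_id δ

lemma stablePost_stablePre {X' X : ProjStable P} {Y Y' : InjStable P} (f : X' ⟶ X) (g : Y ⟶ Y')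
    (δ : Ext1 X.as Y.as) :
    stablePost g (stablePre f δ) = stablePre f (stablePost g δ) := by
  obtain ⟨f, rfl⟩ := projMk_surjective f
  obtain ⟨g, rfl⟩ := injMk_surjective g
  exact post_pre f g δ

variable (R : Type w) [CommRing R] [Linear R A] [∀ n : ℤ, (shiftFunctor A n).Linear R]

/-- The action of the projectively stable category on `Ext¹`, as a bilinear map. -/
def stablePreₗ (X' X : ProjStable P) (Y : P.FullSubcategory) :
    (X' ⟶ X) →ₗ[R] Ext1 X.as Y →ₗ[R] Ext1 X'.as Y :=
  LinearMap.mk₂ R stablePre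
    (fun f g δ => by
      obtain ⟨f, rfl⟩ := projMk_surjective f
      obtain ⟨g, rfl⟩ := projMk_surjective g
      exact add_pre f g δ)
    (fun a f δ => by
      obtain ⟨f, rfl⟩ := projMk_surjective f
      exact Linear.smul_comp _ _ _ a f.hom δ)
    (fun f δ δ' => by
      obtain ⟨f, rfl⟩ := projMk_surjective f
      exact pre_add f δ δ')
    (fun a f δ => by
      obtain ⟨f, rfl⟩ := projMk_surjective f
      exact Linear.comp_smul _ _ _ f.hom a δ)

@[simp] lemma stablePreₗ_apply {X' X : ProjStable P} {Y : P.FullSubcategory} (f : X' ⟶ X)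
    (δ : Ext1 X.as Y) : stablePreₗ R X' X Y f δ = stablePre f δ := rfl

/-- The action of the injectively stable category on `Ext¹`, as a bilinear map. -/
def stablePostₗ (X : P.FullSubcategory) (Y Y' : InjStable P) :
    (Y ⟶ Y') →ₗ[R] Ext1 X Y.as →ₗ[R] Ext1 X Y'.as :=
  LinearMap.mk₂ R stablePost
    (fun f g δ => by
      obtain ⟨f, rfl⟩ := injMk_surjective f
      obtain ⟨g, rfl⟩ := injMk_surjective g
      exact add_post f g δ)
    (fun a f δ => by
      obtain ⟨f, rfl⟩ := injMk_surjective f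
      change δ ≫ (a • f.hom)⟦(1 : ℤ)⟧' = a • (δ ≫ f.hom⟦(1 : ℤ)⟧')
      rw [Functor.map_smul, Linear.comp_smul])
    (fun f δ δ' => by
      obtain ⟨f, rfl⟩ := injMk_surjective f
      exact post_add f δ δ')
    (fun a f δ => by
      obtain ⟨f, rfl⟩ := injMk_surjective f
      exact Linear.smul_comp _ _ _ a δ _)

@[simp] lemma stablePostₗ_apply {X : P.FullSubcategory} {Y Y' : InjStable P} (f : Y ⟶ Y')
    (δ : Ext1 X Y.as) : stablePostₗ R X Y Y' f δ = stablePost f δ := rfl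

end Ext1

end Stable

/-! ### Auslander–Reiten dualities -/

section Duality

variable {A : Type u} [Category.{v} A] [HasZeroObject A] [HasShift A ℤ] [Preadditive A]
  [∀ n : ℤ, (shiftFunctor A n).Additive] [Pretriangulated A] {P : ObjectProperty A}
  {R : Type w} [CommRing R] [Linear R A]
  {I : Type w} [AddCommGroup I] [Module R I]

/-- A functional `φ` on `Ext¹(Z, X)` is an Auslander–Reiten duality between `Z` and `X` if the
pairings `(f, ε) ↦ φ (ε · f)` of `Hom(Z, Y)` with `Ext¹(Y, X)` and `(g, ε) ↦ φ (g · ε)` of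
`Hom(W, X)` with `Ext¹(Z, W)` are non-degenerate modulo projectively, respectively injectively,
trivial morphisms. -/
structure IsARDuality {Z X : P.FullSubcategory} (φ : Ext1 Z X →ₗ[R] I) : Prop where
  proj_left : ∀ {Y : P.FullSubcategory} (f : Z ⟶ Y),
    (∀ ε : Ext1 Y X, φ (Ext1.pre f ε) = 0) → IsProjectivelyTrivial P f
  proj_right : ∀ {Y : P.FullSubcategory} (ε : Ext1 Y X),
    (∀ f : Z ⟶ Y, φ (Ext1.pre f ε) = 0) → ε = 0
  inj_left : ∀ {W : P.FullSubcategory} (g : W ⟶ X),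
    (∀ ε : Ext1 Z W, φ (Ext1.post g ε) = 0) → IsInjectivelyTrivial P g
  inj_right : ∀ {W : P.FullSubcategory} (ε : Ext1 Z W),
    (∀ g : W ⟶ X, φ (Ext1.post g ε) = 0) → ε = 0

/-- A functional that does not kill an almost vanishing extension `δ` is a duality: every non-zero
extension and every morphism with a non-zero action on extensions can be moved to `δ`. -/
lemma IsARDuality.of_almostVanishing [IsExtensionClosed P] {Z X : P.FullSubcategory}
    {δ : Ext1 Z X} (hr : IsRightAlmostVanishing δ) (hl : IsLeftAlmostVanishing δ)
    {φ : Ext1 Z X →ₗ[R] I} (hφ : φ δ ≠ 0) : IsARDuality φ where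
  proj_left f h M ε := by
    by_contra h0
    obtain ⟨u, rfl⟩ := hr.exists_post h0
    rw [Ext1.post_pre] at hφ
    exact hφ (h _)
  proj_right ε h := by
    by_contra h0
    obtain ⟨u, rfl⟩ := hl.exists_pre h0
    exact hφ (h _)
  inj_left g h M ε := by
    by_contra h0
    obtain ⟨u, rfl⟩ := hl.exists_pre h0
    rw [← Ext1.post_pre] at hφ
    exact hφ (h _)
  inj_right ε h := by
    by_contra h0
    obtain ⟨u, rfl⟩ := hr.exists_post h0
    exact hφ (h _)

omit [HasZeroObject A] [Pretriangulated A] in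
lemma post_eq_zero_of_isZero {Z X X' : P.FullSubcategory} (hX : IsZero X) (g : X ⟶ X')
    (ε : Ext1 Z X) : Ext1.post g ε = 0 := by
  rw [hX.eq_of_src g 0, Ext1.zero_post]

omit [HasZeroObject A] [∀ n : ℤ, (shiftFunctor A n).Additive] [Pretriangulated A] in
lemma pre_eq_zero_of_isZero {Z Z' X : P.FullSubcategory} (hZ : IsZero Z) (g : Z' ⟶ Z)
    (ε : Ext1 Z X) : Ext1.pre g ε = 0 := by
  rw [hZ.eq_of_tgt g 0, Ext1.zero_pre]

omit [HasZeroObject A] [Pretriangulated A] in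
lemma IsARDuality.of_isExtProjective {Z X : P.FullSubcategory} (hZ : IsExtProjective P Z)
    (hX : IsZero X) : IsARDuality (0 : Ext1 Z X →ₗ[R] I) where
  proj_left f _ M ε := by
    rw [← Category.id_comp f, Ext1.pre_comp]
    exact hZ M _
  proj_right ε _ := by
    rw [← Ext1.post_id ε]
    exact post_eq_zero_of_isZero hX _ _
  inj_left g _ M ε := by
    rw [hX.eq_of_tgt g 0, Ext1.zero_post]
  inj_right ε _ := by
    rw [← Ext1.pre_id ε]
    exact hZ _ ε

omit [HasZeroObject A] [∀ n : ℤ, (shiftFunctor A n).Additive] [Pretriangulated A] in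
lemma IsARDuality.of_isExtInjective {Z X : P.FullSubcategory} (hX : IsExtInjective P X)
    (hZ : IsZero Z) : IsARDuality (0 : Ext1 Z X →ₗ[R] I) where
  proj_left f _ M ε := by
    rw [hZ.eq_of_src f 0, Ext1.zero_pre]
  proj_right ε _ := by
    rw [← Ext1.post_id ε]
    exact hX _ ε
  inj_left g _ M ε := by
    rw [← Category.comp_id g, Ext1.post_comp]
    exact hX M _
  inj_right ε _ := by
    rw [← Ext1.pre_id ε]
    exact pre_eq_zero_of_isZero hZ _ _

/-! ### Dualities between finite direct sums -/

section Sum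

variable [∀ n : ℤ, (shiftFunctor A n).Linear R]
variable {n : ℕ} {F G : Fin n → P.FullSubcategory} (b : Bicone F) (c : Bicone G)
  (φ : ∀ i, Ext1 (F i) (G i) →ₗ[R] I)

/-- The sum of the functionals `φ i` on the diagonal components of `Ext¹(⨁ F i, ⨁ G i)`. -/
noncomputable def sumFunctional : Ext1 b.pt c.pt →ₗ[R] I :=
  ∑ i, φ i ∘ₗ Ext1.stablePostₗ R (F i) ⟨c.pt⟩ ⟨G i⟩ (injMk (c.π i)) ∘ₗ
    Ext1.stablePreₗ R ⟨F i⟩ ⟨b.pt⟩ c.pt (projMk (b.ι i))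

lemma sumFunctional_apply (ε : Ext1 b.pt c.pt) :
    sumFunctional b c φ ε = ∑ i, φ i (Ext1.post (c.π i) (Ext1.pre (b.ι i) ε)) := by
  simp [sumFunctional]
  rfl

lemma sumFunctional_post (i : Fin n) (ε : Ext1 b.pt (G i)) :
    sumFunctional b c φ (Ext1.post (c.ι i) ε) = φ i (Ext1.pre (b.ι i) ε) := by
  rw [sumFunctional_apply, Finset.sum_eq_single i]
  · rw [← Ext1.post_pre, ← Ext1.post_comp, bicone_ι_π_self c, Ext1.post_id]
  · intro j _ hj
    rw [← Ext1.post_pre, ← Ext1.post_comp, bicone_ι_π_ne c hj.symm, Ext1.zero_post, map_zero]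
  · simp

lemma sumFunctional_pre (i : Fin n) (ε : Ext1 (F i) c.pt) :
    sumFunctional b c φ (Ext1.pre (b.π i) ε) = φ i (Ext1.post (c.π i) ε) := by
  rw [sumFunctional_apply, Finset.sum_eq_single i]
  · rw [← Ext1.pre_comp, bicone_ι_π_self b, Ext1.pre_id]
  · intro j _ hj
    rw [← Ext1.pre_comp, bicone_ι_π_ne b hj, Ext1.zero_pre, Ext1.post_zero, map_zero]
  · simp

variable {b c φ}

omit [HasZeroObject A] [Pretriangulated A] in
lemma eq_zero_of_forall_post_π (hc : ∑ i, c.π i ≫ c.ι i = 𝟙 c.pt) {Y : P.FullSubcategory}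
    {ε : Ext1 Y c.pt} (h : ∀ i, Ext1.post (c.π i) ε = 0) : ε = 0 := by
  rw [← Ext1.post_id ε, ← hc, Ext1.sum_post]
  exact Finset.sum_eq_zero fun i _ => by rw [Ext1.post_comp, h, Ext1.post_zero]

omit [HasZeroObject A] [∀ n : ℤ, (shiftFunctor A n).Additive] [Pretriangulated A] in
lemma eq_zero_of_forall_pre_ι (hb : ∑ i, b.π i ≫ b.ι i = 𝟙 b.pt) {Y : P.FullSubcategory}
    {ε : Ext1 b.pt Y} (h : ∀ i, Ext1.pre (b.ι i) ε = 0) : ε = 0 := by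
  rw [← Ext1.pre_id ε, ← hb, Ext1.sum_pre]
  exact Finset.sum_eq_zero fun i _ => by rw [Ext1.pre_comp, h, Ext1.pre_zero]

lemma IsARDuality.sum (hb : ∑ i, b.π i ≫ b.ι i = 𝟙 b.pt) (hc : ∑ i, c.π i ≫ c.ι i = 𝟙 c.pt)
    (hφ : ∀ i, IsARDuality (φ i)) : IsARDuality (sumFunctional b c φ) where
  proj_left f h M ε := by
    refine eq_zero_of_forall_pre_ι hb fun i => ?_
    rw [← Ext1.pre_comp]
    refine (hφ i).proj_left _ (fun ε => ?_) M ε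
    rw [Ext1.pre_comp, ← sumFunctional_post b c φ, Ext1.post_pre]
    exact h _
  proj_right ε h := by
    refine eq_zero_of_forall_post_π hc fun i => (hφ i).proj_right _ fun f => ?_
    rw [← Ext1.post_pre, ← sumFunctional_pre b c φ, ← Ext1.pre_comp]
    exact h _
  inj_left g h M ε := by
    refine eq_zero_of_forall_post_π hc fun i => ?_
    rw [← Ext1.post_comp]
    refine (hφ i).inj_left _ (fun ε => ?_) M ε
    rw [Ext1.post_comp, ← sumFunctional_pre b c φ, ← Ext1.post_pre]
    exact h _
  inj_right ε h := by
    refine eq_zero_of_forall_pre_ι hb fun i => (hφ i).inj_right _ fun g => ?_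
    rw [Ext1.post_pre, ← sumFunctional_post b c φ, ← Ext1.post_comp]
    exact h _

end Sum

instance [IsExtensionClosed P] : P.IsClosedUnderIsomorphisms where
  -- an isomorphism `X ≅ Y` is the first map of a triangle `X ⟶ Y ⟶ 0`
  of_iso {X Y} e hX := by
    obtain ⟨Z, hZ, hPZ⟩ := P.exists_prop_of_containsZero
    have h : Triangle.mk e.hom (0 : Y ⟶ Z) 0 ∈ distTriang A :=
      (Triangle.distinguished_iff_of_isZero₃ _ hZ).2 e.isIso_hom
    exact IsExtensionClosed.ext_closed _ h hX hPZ

instance [IsExtensionClosed P] : HasFiniteBiproducts P.FullSubcategory := by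
  have : P.IsTriangulatedClosed₂ :=
    ⟨fun T hT h₁ h₃ => P.le_isoClosure _ (IsExtensionClosed.ext_closed T hT h₁ h₃)⟩
  have : P.IsClosedUnderBinaryProducts := by
    refine ⟨?_⟩
    rintro X ⟨p⟩
    refine P.prop_of_iso ?_ (P.ext_of_isTriangulatedClosed₂ _
      (binaryProductTriangle_distinguished _ _)
      (p.prop_diag_obj (.mk .left)) (p.prop_diag_obj (.mk .right)))
    exact IsLimit.conePointUniqueUpToIso (prodIsProd _ _)
      ((IsLimit.postcomposeHomEquiv (diagramIsoPair p.diag) _).2 p.isLimit)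
  have : P.IsClosedUnderFiniteProducts := .mk'
  exact HasFiniteBiproducts.of_hasFiniteProducts

/-- In a Krull–Schmidt category every object, including zero, is the point of a finite bicone of
strongly indecomposable objects with `∑ π i ≫ ι i = 1`. -/
lemma IsKrullSchmidt.exists_bicone {C : Type*} [Category* C] [Preadditive C]
    (h : IsKrullSchmidt C) (Z : C) : ∃ (n : ℕ) (F : Fin n → C) (b : Bicone F),
      (∀ i, IsStronglyIndecomposable (F i)) ∧ ∑ i, b.π i ≫ b.ι i = 𝟙 b.pt ∧ b.pt = Z := by
  by_cases hZ : IsZero Z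
  · exact ⟨0, Fin.elim0, ⟨Z, fun i => i.elim0, fun i => i.elim0, fun i => i.elim0⟩,
      fun i => i.elim0, hZ.eq_of_src _ _, rfl⟩
  · obtain ⟨n, F, b, hF, ⟨hb⟩, ⟨e⟩⟩ := h Z hZ
    refine ⟨n, F, ⟨Z, fun i => e.hom ≫ b.π i, fun i => b.ι i ≫ e.inv, fun i j => ?_⟩, hF, ?_, rfl⟩
    · simpa using b.ι_π i j
    · have := IsBilimit.total hb
      calc ∑ i, (e.hom ≫ b.π i) ≫ b.ι i ≫ e.inv = e.hom ≫ (∑ i, b.π i ≫ b.ι i) ≫ e.inv := by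
            simp [Preadditive.comp_sum, Preadditive.sum_comp]
        _ = 𝟙 Z := by simp [this]

section Existence

variable [IsExtensionClosed P] [∀ n : ℤ, (shiftFunctor A n).Linear R]

lemma exists_isARDuality_of_right (hI : IsInjectiveCogenerator R I)
    (hKS : IsKrullSchmidt P.FullSubcategory) (h : HasAlmostSplitSequencesOnTheRight P)
    (Z : P.FullSubcategory) :
    ∃ (X : P.FullSubcategory) (φ : Ext1 Z X →ₗ[R] I), IsARDuality φ := by
  obtain ⟨n, F, b, hF, hb, rfl⟩ := hKS.exists_bicone Z
  have key : ∀ i, ∃ (X : P.FullSubcategory) (φ : Ext1 (F i) X →ₗ[R] I), IsARDuality φ := by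
    intro i
    by_cases hi : IsExtProjective P (F i)
    · have : HasZeroObject P.FullSubcategory := hasZeroObject_of_hasFiniteBiproducts _
      obtain ⟨O, hO⟩ := HasZeroObject.zero (C := P.FullSubcategory)
      exact ⟨O, 0, .of_isExtProjective hi hO⟩
    · obtain ⟨X, Y, f, g, hs⟩ := h _ (hF i) hi
      obtain ⟨δ, hr, hl⟩ := hs.exists_almostVanishing
      obtain ⟨φ, hφ⟩ := hI.exists_apply_ne_zero hr.1
      exact ⟨X, φ, .of_almostVanishing hr hl hφ⟩
  choose G φ hφ using key
  exact ⟨_, _, .sum (c := biproduct.bicone G) hb (IsBilimit.total (biproduct.isBilimit G)) hφ⟩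

lemma exists_isARDuality_of_left (hI : IsInjectiveCogenerator R I)
    (hKS : IsKrullSchmidt P.FullSubcategory) (h : HasAlmostSplitSequencesOnTheLeft P)
    (X : P.FullSubcategory) :
    ∃ (Z : P.FullSubcategory) (φ : Ext1 Z X →ₗ[R] I), IsARDuality φ := by
  obtain ⟨n, G, c, hG, hc, rfl⟩ := hKS.exists_bicone X
  have key : ∀ i, ∃ (Z : P.FullSubcategory) (φ : Ext1 Z (G i) →ₗ[R] I), IsARDuality φ := by
    intro i
    by_cases hi : IsExtInjective P (G i)
    · have : HasZeroObject P.FullSubcategory := hasZeroObject_of_hasFiniteBiproducts _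
      obtain ⟨O, hO⟩ := HasZeroObject.zero (C := P.FullSubcategory)
      exact ⟨O, 0, .of_isExtInjective hi hO⟩
    · obtain ⟨Y, Z, f, g, hs⟩ := h _ (hG i) hi
      obtain ⟨δ, hr, hl⟩ := hs.exists_almostVanishing
      obtain ⟨φ, hφ⟩ := hI.exists_apply_ne_zero hr.1
      exact ⟨Z, φ, .of_almostVanishing hr hl hφ⟩
  choose F φ hφ using key
  exact ⟨_, _, .sum (b := biproduct.bicone F) (IsBilimit.total (biproduct.isBilimit F)) hc hφ⟩

end Existence

end Duality

section Perfect

variable {A : Type u} [Category.{v} A] [HasZeroObject A] [HasShift A ℤ] [Preadditive A]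
  [∀ n : ℤ, (shiftFunctor A n).Additive] [Pretriangulated A] {P : ObjectProperty A}
  {R : Type w} [CommRing R] [Linear R A] [∀ n : ℤ, (shiftFunctor A n).Linear R]
  {I : Type w} [AddCommGroup I] [Module R I]

/-! ### Perfect pairings and transport of morphisms -/

variable (R) in
/-- The quotient map onto the morphisms of the projectively stable category. -/
def projMkₗ (X Y : P.FullSubcategory) : (X ⟶ Y) →ₗ[R] ((⟨X⟩ : ProjStable P) ⟶ ⟨Y⟩) where
  toFun f := projMk f
  map_add' _ _ := rfl
  map_smul' _ _ := rfl

variable (R) in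
/-- The quotient map onto the morphisms of the injectively stable category. -/
def injMkₗ (X Y : P.FullSubcategory) : (X ⟶ Y) →ₗ[R] ((⟨X⟩ : InjStable P) ⟶ ⟨Y⟩) where
  toFun f := injMk f
  map_add' _ _ := rfl
  map_smul' _ _ := rfl

lemma IsHomReflexive.projStable (hI : IsInjectiveCogenerator R I) (h : IsHomReflexive P R I)
    (X Y : ProjStable P) : IsReflexive R I (X ⟶ Y) :=
  (h X.as Y.as).of_surjective hI (projMkₗ R X.as Y.as) projMk_surjective

lemma IsHomReflexive.injStable (hI : IsInjectiveCogenerator R I) (h : IsHomReflexive P R I)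
    (X Y : InjStable P) : IsReflexive R I (X ⟶ Y) :=
  (h X.as Y.as).of_surjective hI (injMkₗ R X.as Y.as) injMk_surjective

/-- The pairing `(f, ε) ↦ φ (ε · f)` of the projectively stable `Hom(Z, Y)` with `Ext¹(Y, X)`. -/
def projPairing {Z X : P.FullSubcategory} (φ : Ext1 Z X →ₗ[R] I) (Y : ProjStable P) :
    ((⟨Z⟩ : ProjStable P) ⟶ Y) →ₗ[R] Ext1 Y.as X →ₗ[R] I :=
  (Ext1.stablePreₗ R ⟨Z⟩ Y X).compr₂ φ

/-- The pairing `(g, ε) ↦ φ (g · ε)` of the injectively stable `Hom(W, X)` with `Ext¹(Z, W)`. -/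
def injPairing {Z X : P.FullSubcategory} (φ : Ext1 Z X →ₗ[R] I) (W : InjStable P) :
    (W ⟶ (⟨X⟩ : InjStable P)) →ₗ[R] Ext1 Z W.as →ₗ[R] I :=
  (Ext1.stablePostₗ R Z W ⟨X⟩).compr₂ φ

namespace IsARDuality

section

variable {Z X : P.FullSubcategory} {φ : Ext1 Z X →ₗ[R] I} (hφ : IsARDuality φ)

include hφ

lemma projPairing_left (Y : ProjStable P) (f : (⟨Z⟩ : ProjStable P) ⟶ Y)
    (h : ∀ ε, projPairing φ Y f ε = 0) : f = 0 := by
  obtain ⟨f, rfl⟩ := projMk_surjective f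
  exact (projMk_eq_zero_iff f).2 (hφ.proj_left f h)

lemma projPairing_right (Y : ProjStable P) (ε : Ext1 Y.as X)
    (h : ∀ f, projPairing φ Y f ε = 0) : ε = 0 :=
  hφ.proj_right ε fun f => h (projMk f)

lemma injPairing_left (W : InjStable P) (g : W ⟶ (⟨X⟩ : InjStable P))
    (h : ∀ ε, injPairing φ W g ε = 0) : g = 0 := by
  obtain ⟨g, rfl⟩ := injMk_surjective g
  exact (injMk_eq_zero_iff g).2 (hφ.inj_left g h)

lemma injPairing_right (W : InjStable P) (ε : Ext1 Z W.as)
    (h : ∀ g, injPairing φ W g ε = 0) : ε = 0 :=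
  hφ.inj_right ε fun g => h (injMk g)

variable (hI : IsInjectiveCogenerator R I) (hHom : IsHomReflexive P R I)

include hI hHom

lemma isReflexive_ext1 (Y : P.FullSubcategory) : IsReflexive R I (Ext1 Y X) :=
  (hHom.projStable hI ⟨Z⟩ ⟨Y⟩).of_nondegenerate hI (projPairing φ ⟨Y⟩)
    (hφ.projPairing_left _) (hφ.projPairing_right _)

/-- The isomorphism of the projectively stable `Hom(Z, Y)` with `D Ext¹(Y, X)`. -/
noncomputable def projEquiv (Y : ProjStable P) :
    ((⟨Z⟩ : ProjStable P) ⟶ Y) ≃ₗ[R] (Ext1 Y.as X →ₗ[R] I) :=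
  LinearEquiv.ofBijective (projPairing φ Y) <|
    bijective_of_nondegenerate hI (hHom.projStable hI _ _) _
      (hφ.projPairing_left _) (hφ.projPairing_right _)

/-- The isomorphism of the injectively stable `Hom(W, X)` with `D Ext¹(Z, W)`. -/
noncomputable def injEquiv (W : InjStable P) :
    (W ⟶ (⟨X⟩ : InjStable P)) ≃ₗ[R] (Ext1 Z W.as →ₗ[R] I) :=
  LinearEquiv.ofBijective (injPairing φ W) <|
    bijective_of_nondegenerate hI (hHom.injStable hI _ _) _
      (hφ.injPairing_left _) (hφ.injPairing_right _)

end

variable (hI : IsInjectiveCogenerator R I) (hHom : IsHomReflexive P R I)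
  {Z Z' Z'' X X' X'' : P.FullSubcategory}
  {φ : Ext1 Z X →ₗ[R] I} {φ' : Ext1 Z' X' →ₗ[R] I} {φ'' : Ext1 Z'' X'' →ₗ[R] I}
  (hφ : IsARDuality φ) (hφ' : IsARDuality φ') (hφ'' : IsARDuality φ'')

/-- Dualities `φ` between `Z` and `X` and `φ'` between `Z'` and `X'` identify the projectively
stable `Hom(Z, Z')` with the injectively stable `Hom(X, X')`, as both are isomorphic to
`D Ext¹(Z', X)`. -/
noncomputable def homEquiv :
    ((⟨Z⟩ : ProjStable P) ⟶ ⟨Z'⟩) ≃ₗ[R] ((⟨X⟩ : InjStable P) ⟶ ⟨X'⟩) :=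
  (hφ.projEquiv hI hHom ⟨Z'⟩).trans (hφ'.injEquiv hI hHom ⟨X⟩).symm

lemma apply_homEquiv (f : (⟨Z⟩ : ProjStable P) ⟶ ⟨Z'⟩) (δ : Ext1 Z' X) :
    φ' (Ext1.stablePost (homEquiv hI hHom hφ hφ' f) δ) = φ (Ext1.stablePre f δ) := by
  have h : hφ'.injEquiv hI hHom ⟨X⟩ (homEquiv hI hHom hφ hφ' f) =
      hφ.projEquiv hI hHom ⟨Z'⟩ f := LinearEquiv.apply_symm_apply _ _
  exact LinearMap.congr_fun h δ

lemma apply_comp_left {Y : ProjStable P} (u : (⟨Z⟩ : ProjStable P) ⟶ ⟨Z'⟩)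
    (f : (⟨Z'⟩ : ProjStable P) ⟶ Y) (δ : Ext1 Y.as X) :
    φ (Ext1.stablePre (u ≫ f) δ) =
      φ' (Ext1.stablePre f (Ext1.stablePost (homEquiv hI hHom hφ hφ' u) δ)) := by
  rw [← Ext1.stablePost_stablePre (Y := ⟨X⟩) (Y' := ⟨X'⟩) (X' := ⟨Z'⟩), apply_homEquiv,
    Ext1.stablePre_comp (X' := ⟨Z'⟩)]

lemma apply_comp_right {W : InjStable P} (f : W ⟶ (⟨X⟩ : InjStable P))
    (v : (⟨X⟩ : InjStable P) ⟶ ⟨X'⟩) (δ : Ext1 Z' W.as) :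
    φ' (Ext1.stablePost (f ≫ v) δ) =
      φ (Ext1.stablePost f (Ext1.stablePre ((homEquiv hI hHom hφ hφ').symm v) δ)) := by
  rw [Ext1.stablePost_stablePre (Y' := ⟨X⟩) (X' := ⟨Z⟩) (X := ⟨Z'⟩),
    ← apply_homEquiv hI hHom hφ hφ', LinearEquiv.apply_symm_apply,
    Ext1.stablePost_comp (Y' := ⟨X⟩)]

lemma homEquiv_unique {f : (⟨Z⟩ : ProjStable P) ⟶ ⟨Z'⟩} {g : (⟨X⟩ : InjStable P) ⟶ ⟨X'⟩}
    (h : ∀ δ : Ext1 Z' X, φ' (Ext1.stablePost g δ) = φ (Ext1.stablePre f δ)) :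
    homEquiv hI hHom hφ hφ' f = g := by
  apply (hφ'.injEquiv hI hHom ⟨X⟩).injective
  refine LinearMap.ext fun δ => ?_
  exact (apply_homEquiv hI hHom hφ hφ' f δ).trans (h δ).symm

lemma homEquiv_id : homEquiv hI hHom hφ hφ (𝟙 _) = 𝟙 _ :=
  homEquiv_unique hI hHom hφ hφ fun δ => by
    rw [Ext1.stablePost_id (Y := ⟨X⟩), Ext1.stablePre_id (X := ⟨Z⟩)]

lemma homEquiv_comp (f : (⟨Z⟩ : ProjStable P) ⟶ ⟨Z'⟩) (g : (⟨Z'⟩ : ProjStable P) ⟶ ⟨Z''⟩) :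
    homEquiv hI hHom hφ hφ'' (f ≫ g) =
      homEquiv hI hHom hφ hφ' f ≫ homEquiv hI hHom hφ' hφ'' g :=
  homEquiv_unique hI hHom hφ hφ'' fun δ => by
    rw [Ext1.stablePost_comp (Y := ⟨X⟩) (Y' := ⟨X'⟩), apply_homEquiv,
      ← Ext1.stablePost_stablePre (Y := ⟨X⟩) (X' := ⟨Z'⟩) (X := ⟨Z''⟩), apply_homEquiv,
      Ext1.stablePre_comp (X' := ⟨Z'⟩) (X := ⟨Z''⟩)]

/-- An object in duality with `Z` is determined by `Z` up to isomorphism in the injectively stable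
category. -/
noncomputable def isoOfDualities {φ' : Ext1 Z X' →ₗ[R] I} (hφ' : IsARDuality φ') :
    (⟨X⟩ : InjStable P) ≅ ⟨X'⟩ where
  hom := homEquiv hI hHom hφ hφ' (𝟙 _)
  inv := homEquiv hI hHom hφ' hφ (𝟙 _)
  hom_inv_id := by rw [← homEquiv_comp, Category.id_comp, homEquiv_id]
  inv_hom_id := by rw [← homEquiv_comp, Category.id_comp, homEquiv_id]

end IsARDuality

/-! ### The Auslander–Reiten functors of a family of dualities -/

section Functors

variable (hI : IsInjectiveCogenerator R I) (hHom : IsHomReflexive P R I)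

section Right

variable {T : P.FullSubcategory → P.FullSubcategory} {φ : ∀ Z, Ext1 Z (T Z) →ₗ[R] I}
  (hφ : ∀ Z, IsARDuality (φ Z))

/-- The functor `Z ↦ T Z` for a choice of dualities between `Z` and `T Z`. -/
noncomputable def rightARFunctor : ProjStable P ⥤ InjStable P where
  obj Z := ⟨T Z.as⟩
  map {Z Z'} f := IsARDuality.homEquiv hI hHom (hφ Z.as) (hφ Z'.as) f
  map_id Z := IsARDuality.homEquiv_id hI hHom (hφ Z.as)
  map_comp {Z Z' Z''} f g :=
    IsARDuality.homEquiv_comp hI hHom (hφ Z.as) (hφ Z'.as) (hφ Z''.as) f g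

instance : (rightARFunctor hI hHom hφ).Full where
  map_surjective {Z Z'} := (IsARDuality.homEquiv hI hHom (hφ Z.as) (hφ Z'.as)).surjective

instance : (rightARFunctor hI hHom hφ).Faithful where
  map_injective {Z Z'} _ _ h :=
    (IsARDuality.homEquiv hI hHom (hφ Z.as) (hφ Z'.as)).injective h

lemma isRightAuslanderReitenFunctor :
    IsRightAuslanderReitenFunctor P R I (rightARFunctor hI hHom hφ) := by
  refine ⟨⟨fun {Z Z'} f g => map_add (IsARDuality.homEquiv hI hHom (hφ Z.as) (hφ Z'.as)) f g⟩,
    fun X Y => (hφ X.as).projEquiv hI hHom Y, ?_, ?_⟩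
  · intro X' X Y u f δ
    exact IsARDuality.apply_comp_left hI hHom (hφ X'.as) (hφ X.as) u f δ
  · intro X Y Y' f v δ
    exact congrArg (φ X.as) (Ext1.stablePre_comp f v δ)

lemma rightARFunctor_essSurj
    (h : ∀ X, ∃ (Z : P.FullSubcategory) (ψ : Ext1 Z X →ₗ[R] I), IsARDuality ψ) :
    (rightARFunctor hI hHom hφ).EssSurj where
  mem_essImage X := by
    obtain ⟨Z, ψ, hψ⟩ := h X.as
    exact ⟨⟨Z⟩, ⟨IsARDuality.isoOfDualities hI hHom (hφ Z) hψ⟩⟩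

end Right

section Left

variable {S : P.FullSubcategory → P.FullSubcategory} {φ : ∀ X, Ext1 (S X) X →ₗ[R] I}
  (hφ : ∀ X, IsARDuality (φ X))

/-- The functor `X ↦ S X` for a choice of dualities between `S X` and `X`. -/
noncomputable def leftARFunctor : InjStable P ⥤ ProjStable P where
  obj X := ⟨S X.as⟩
  map {X X'} f := (IsARDuality.homEquiv hI hHom (hφ X.as) (hφ X'.as)).symm f
  map_id X := by
    rw [LinearEquiv.symm_apply_eq]
    exact (IsARDuality.homEquiv_id hI hHom (hφ X.as)).symm
  map_comp {X X' X''} f g := by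
    rw [LinearEquiv.symm_apply_eq, IsARDuality.homEquiv_comp hI hHom (hφ X.as) (hφ X'.as),
      LinearEquiv.apply_symm_apply, LinearEquiv.apply_symm_apply]

instance : (leftARFunctor hI hHom hφ).Full where
  map_surjective {X X'} := (IsARDuality.homEquiv hI hHom (hφ X.as) (hφ X'.as)).symm.surjective

lemma isLeftAuslanderReitenFunctor :
    IsLeftAuslanderReitenFunctor P R I (leftARFunctor hI hHom hφ) := by
  refine ⟨⟨fun {X X'} f g =>
      map_add (IsARDuality.homEquiv hI hHom (hφ X.as) (hφ X'.as)).symm f g⟩,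
    fun X Y => (hφ Y.as).injEquiv hI hHom X, ?_, ?_⟩
  · intro X' X Y u f δ
    exact congrArg (φ Y.as) (Ext1.stablePost_comp u f δ)
  · intro X Y Y' f v δ
    exact IsARDuality.apply_comp_right hI hHom (hφ Y.as) (hφ Y'.as) f v δ

end Left

end Functors

end Perfect

/-! ### Almost split sequences from Auslander–Reiten functors -/

section Nonisomorphisms

variable {C : Type*} [Category* C] [Preadditive C] (R : Type*) [CommRing R] [Linear R C]

/-- The radical of the endomorphism ring of a strongly indecomposable object. -/
def nonisoSubmodule {X : C} (hX : IsStronglyIndecomposable X) : Submodule R (X ⟶ X) where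
  carrier := {a | ¬ IsIso a}
  add_mem' {a b} ha hb := by
    have : IsLocalRing (End X) := hX
    have h := IsLocalRing.nonunits_add (R := End X) (a := a) (b := b)
    simp only [mem_nonunits_iff, isUnit_iff_isIso] at h
    exact h ha hb
  zero_mem' := by
    have : IsLocalRing (End X) := hX
    have h : (0 : End X) ∈ nonunits (End X) := not_isUnit_zero
    rwa [mem_nonunits_iff, isUnit_iff_isIso] at h
  smul_mem' r a ha h := ha <| by
    have h₁ : a ≫ (r • inv (r • a)) = 𝟙 X := by
      rw [Linear.comp_smul, ← Linear.smul_comp, IsIso.hom_inv_id]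
    have h₂ : (r • inv (r • a)) ≫ a = 𝟙 X := by
      rw [Linear.smul_comp, ← Linear.comp_smul, IsIso.inv_hom_id]
    exact ⟨_, h₁, h₂⟩

end Nonisomorphisms

section AlmostSplit

variable {A : Type u} [Category.{v} A] [HasZeroObject A] [HasShift A ℤ] [Preadditive A]
  [∀ n : ℤ, (shiftFunctor A n).Additive] [Pretriangulated A] {P : ObjectProperty A}
  {R : Type w} [CommRing R] [Linear R A] [∀ n : ℤ, (shiftFunctor A n).Linear R]
  {I : Type w} [AddCommGroup I] [Module R I]

/-- If `D Ext¹(-, X)` is represented by `Z` on the projectively stable category, then a functional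
on the stable endomorphism ring of `Z` that vanishes on the radical but not at the identity is the
evaluation at some `δ`, by reflexivity, and `δ` is almost vanishing. -/
lemma exists_isRightAlmostVanishing (hI : IsInjectiveCogenerator R I)
    (hHom : IsHomReflexive P R I) {Z X : P.FullSubcategory} (hZ : IsStronglyIndecomposable Z)
    (hZ' : ¬ IsExtProjective P Z)
    (θ : ∀ Y : ProjStable P, ((⟨Z⟩ : ProjStable P) ⟶ Y) ≃ₗ[R] (Ext1 Y.as X →ₗ[R] I))
    (hθ : ∀ (Y Y' : ProjStable P) (f : (⟨Z⟩ : ProjStable P) ⟶ Y) (v : Y ⟶ Y')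
      (δ : Ext1 Y'.as X), θ Y' (f ≫ v) δ = θ Y f (Ext1.stablePre v δ)) :
    ∃ δ : Ext1 Z X, IsRightAlmostVanishing δ := by
  have h1 : 𝟙 (⟨Z⟩ : ProjStable P) ∉
      (nonisoSubmodule R hZ).map (projMkₗ R Z Z) := by
    rintro ⟨a, (ha : ¬ IsIso a), ha'⟩
    have h2 : IsProjectivelyTrivial P (𝟙 Z - a) := by
      rw [← projMk_eq_zero_iff, projMk, Functor.map_sub, sub_eq_zero]
      exact ha'.symm
    have := (isIso_or_isIso_sub hZ a).resolve_left ha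
    exact hZ' fun M ε => by
      rw [← IsIso.inv_hom_id (𝟙 Z - a), Ext1.pre_comp, h2, Ext1.pre_zero]
  obtain ⟨l, hl, hl'⟩ := hI.exists_le_ker _ h1
  obtain ⟨δ, hδ⟩ := (bijective_flip_of_nondegenerate hI (hHom.projStable hI ⟨Z⟩ ⟨Z⟩)
    (θ ⟨Z⟩).toLinearMap
    (fun m hm => (θ ⟨Z⟩).map_eq_zero_iff.1 (LinearMap.ext hm))
    (fun ε hε => hI.eq_zero_of_forall fun ψ => by
      obtain ⟨m, rfl⟩ := (θ ⟨Z⟩).surjective ψ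
      exact hε m)).2 l
  have hδ' : ∀ f, θ ⟨Z⟩ f δ = l f := fun f => LinearMap.congr_fun hδ f
  refine ⟨δ, ?_, fun M h hh => hI.eq_zero_of_forall fun ψ => ?_⟩
  · rintro rfl
    exact hl (by rw [← hδ', map_zero])
  · obtain ⟨g, rfl⟩ := (θ ⟨M⟩).surjective ψ
    obtain ⟨g, rfl⟩ := projMk_surjective g
    have := hθ ⟨M⟩ ⟨Z⟩ (projMk g) (projMk h) δ
    rw [Ext1.stablePre_projMk] at this
    rw [← this, hδ']
    refine hl' _ ⟨g ≫ h, fun (h0 : IsIso (g ≫ h)) => hh ⟨⟨inv (g ≫ h) ≫ g, ?_⟩⟩, rfl⟩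
    rw [Category.assoc, IsIso.inv_hom_id]

/-- The dual of `exists_isRightAlmostVanishing`. -/
lemma exists_isLeftAlmostVanishing (hI : IsInjectiveCogenerator R I)
    (hHom : IsHomReflexive P R I) {Z X : P.FullSubcategory} (hX : IsStronglyIndecomposable X)
    (hX' : ¬ IsExtInjective P X)
    (θ : ∀ W : InjStable P, (W ⟶ (⟨X⟩ : InjStable P)) ≃ₗ[R] (Ext1 Z W.as →ₗ[R] I))
    (hθ : ∀ (W' W : InjStable P) (u : W' ⟶ W) (f : W ⟶ (⟨X⟩ : InjStable P))
      (δ : Ext1 Z W'.as), θ W' (u ≫ f) δ = θ W f (Ext1.stablePost u δ)) :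
    ∃ δ : Ext1 Z X, IsLeftAlmostVanishing δ := by
  have h1 : 𝟙 (⟨X⟩ : InjStable P) ∉
      (nonisoSubmodule R hX).map (injMkₗ R X X) := by
    rintro ⟨a, (ha : ¬ IsIso a), ha'⟩
    have h2 : IsInjectivelyTrivial P (𝟙 X - a) := by
      rw [← injMk_eq_zero_iff, injMk, Functor.map_sub, sub_eq_zero]
      exact ha'.symm
    have := (isIso_or_isIso_sub hX a).resolve_left ha
    exact hX' fun M ε => by
      rw [← IsIso.hom_inv_id (𝟙 X - a), Ext1.post_comp, h2, Ext1.post_zero]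
  obtain ⟨l, hl, hl'⟩ := hI.exists_le_ker _ h1
  obtain ⟨δ, hδ⟩ := (bijective_flip_of_nondegenerate hI (hHom.injStable hI ⟨X⟩ ⟨X⟩)
    (θ ⟨X⟩).toLinearMap
    (fun m hm => (θ ⟨X⟩).map_eq_zero_iff.1 (LinearMap.ext hm))
    (fun ε hε => hI.eq_zero_of_forall fun ψ => by
      obtain ⟨m, rfl⟩ := (θ ⟨X⟩).surjective ψ
      exact hε m)).2 l
  have hδ' : ∀ f, θ ⟨X⟩ f δ = l f := fun f => LinearMap.congr_fun hδ f
  refine ⟨δ, ?_, fun M h hh => hI.eq_zero_of_forall fun ψ => ?_⟩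
  · rintro rfl
    exact hl (by rw [← hδ', map_zero])
  · obtain ⟨g, rfl⟩ := (θ ⟨M⟩).surjective ψ
    obtain ⟨g, rfl⟩ := injMk_surjective g
    have := hθ ⟨X⟩ ⟨M⟩ (injMk h) (injMk g) δ
    rw [Ext1.stablePost_injMk] at this
    rw [← this, hδ']
    refine hl' _ ⟨h ≫ g, fun (h0 : IsIso (h ≫ g)) => hh ⟨⟨g ≫ inv (h ≫ g), ?_⟩⟩, rfl⟩
    rw [← Category.assoc, IsIso.hom_inv_id]

variable [IsExtensionClosed P]

lemma IsRightAuslanderReitenFunctor.hasAlmostSplitSequencesOnTheRight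
    (hI : IsInjectiveCogenerator R I) (hHom : IsHomReflexive P R I)
    (hKS : IsKrullSchmidt P.FullSubcategory) {τ : ProjStable P ⥤ InjStable P}
    (hτ : IsRightAuslanderReitenFunctor P R I τ) : HasAlmostSplitSequencesOnTheRight P := by
  intro Z hZ hZ'
  obtain ⟨-, Θ, -, hΘ⟩ := hτ
  obtain ⟨δ, hδ⟩ := exists_isRightAlmostVanishing hI hHom hZ hZ' (Θ ⟨Z⟩) (hΘ ⟨Z⟩)
  -- a component of `δ` at a strongly indecomposable summand of `τ Z` is still almost vanishing
  generalize (τ.obj ⟨Z⟩).as = T at δ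
  obtain ⟨n, F, b, hF, hb, rfl⟩ := hKS.exists_bicone T
  obtain ⟨i, hi⟩ : ∃ i, Ext1.post (b.π i) δ ≠ 0 := by
    by_contra! h
    exact hδ.1 (eq_zero_of_forall_post_π hb h)
  have hr : IsRightAlmostVanishing (Ext1.post (b.π i) δ) :=
    ⟨hi, fun M h hh => by rw [← Ext1.post_pre, hδ.2 M h hh, Ext1.post_zero]⟩
  exact ⟨F i, exists_isAlmostSplitSequence (hF i) hZ hr (hr.isLeftAlmostVanishing (hF i))⟩

lemma IsLeftAuslanderReitenFunctor.hasAlmostSplitSequencesOnTheLeft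
    (hI : IsInjectiveCogenerator R I) (hHom : IsHomReflexive P R I)
    (hKS : IsKrullSchmidt P.FullSubcategory) {τ : InjStable P ⥤ ProjStable P}
    (hτ : IsLeftAuslanderReitenFunctor P R I τ) : HasAlmostSplitSequencesOnTheLeft P := by
  intro X hX hX'
  obtain ⟨-, Ω, hΩ, -⟩ := hτ
  obtain ⟨δ, hδ⟩ := exists_isLeftAlmostVanishing hI hHom hX hX' (fun W => Ω W ⟨X⟩)
    (fun W' W => hΩ W' W ⟨X⟩)
  generalize (τ.obj ⟨X⟩).as = T at δ
  obtain ⟨n, F, b, hF, hb, rfl⟩ := hKS.exists_bicone T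
  obtain ⟨i, hi⟩ : ∃ i, Ext1.pre (b.ι i) δ ≠ 0 := by
    by_contra! h
    exact hδ.1 (eq_zero_of_forall_pre_ι hb h)
  have hl : IsLeftAlmostVanishing (Ext1.pre (b.ι i) δ) :=
    ⟨hi, fun M h hh => by rw [Ext1.post_pre, hδ.2 M h hh, Ext1.pre_zero]⟩
  obtain ⟨Y, f, g, h⟩ :=
    exists_isAlmostSplitSequence hX (hF i) (hl.isRightAlmostVanishing (hF i)) hl
  exact ⟨Y, F i, f, g, h⟩

end AlmostSplit

/-! ### Inverses of Auslander–Reiten equivalences -/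

section Inverse

variable {A : Type u} [Category.{v} A] [HasZeroObject A] [HasShift A ℤ] [Preadditive A]
  [∀ n : ℤ, (shiftFunctor A n).Additive] [Pretriangulated A] {P : ObjectProperty A}
  {R : Type w} [CommRing R] [Linear R A] [∀ n : ℤ, (shiftFunctor A n).Linear R]
  {I : Type w} [AddCommGroup I] [Module R I]

/-- A full right Auslander–Reiten functor is `R`-linear: by fullness `τ (r f) - r τ f = τ h` for
some `h`, and naturality of the isomorphisms forces `h = 0`. -/
lemma IsRightAuslanderReitenFunctor.linear {τ : ProjStable P ⥤ InjStable P}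
    (hτ : IsRightAuslanderReitenFunctor P R I τ) [τ.Full] : τ.Linear R where
  map_smul {X Y} f r := by
    have := hτ.1
    obtain ⟨-, Θ, hΘ, -⟩ := hτ
    have key : ∀ (g : X ⟶ Y) δ, Θ X Y g δ = Θ Y Y (𝟙 Y) (Ext1.stablePost (τ.map g) δ) :=
      fun g δ => by rw [← hΘ, Category.comp_id]
    obtain ⟨h, hh⟩ := τ.map_surjective (τ.map (r • f) - r • τ.map f)
    have h0 : h = 0 := by
      rw [← (Θ X Y).map_eq_zero_iff]
      ext δ
      rw [key, hh, ← Ext1.stablePostₗ_apply R, map_sub, map_smul, LinearMap.sub_apply,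
        LinearMap.smul_apply, map_sub, map_smul, Ext1.stablePostₗ_apply, Ext1.stablePostₗ_apply,
        ← key, ← key, map_smul, LinearMap.smul_apply, sub_self, LinearMap.zero_apply]
    rw [h0, τ.map_zero, eq_comm, sub_eq_zero] at hh
    exact hh

lemma IsLeftAuslanderReitenFunctor.linear {τ : InjStable P ⥤ ProjStable P}
    (hτ : IsLeftAuslanderReitenFunctor P R I τ) [τ.Full] : τ.Linear R where
  map_smul {X Y} f r := by
    have := hτ.1
    obtain ⟨-, Ω, -, hΩ⟩ := hτ
    have key : ∀ (g : X ⟶ Y) δ, Ω X Y g δ = Ω X X (𝟙 X) (Ext1.stablePre (τ.map g) δ) :=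
      fun g δ => by rw [← hΩ, Category.id_comp]
    obtain ⟨h, hh⟩ := τ.map_surjective (τ.map (r • f) - r • τ.map f)
    have h0 : h = 0 := by
      rw [← (Ω X Y).map_eq_zero_iff]
      ext δ
      rw [key, hh, ← Ext1.stablePreₗ_apply R, map_sub, map_smul, LinearMap.sub_apply,
        LinearMap.smul_apply, map_sub, map_smul, Ext1.stablePreₗ_apply, Ext1.stablePreₗ_apply,
        ← key, ← key, map_smul, LinearMap.smul_apply, sub_self, LinearMap.zero_apply]
    rw [h0, τ.map_zero, eq_comm, sub_eq_zero] at hh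
    exact hh

variable (R) in
/-- An isomorphism of the injectively stable category acts invertibly on `Ext¹`. -/
def stablePostEquiv (Z : P.FullSubcategory) {X Y : InjStable P} (e : X ≅ Y) :
    Ext1 Z X.as ≃ₗ[R] Ext1 Z Y.as :=
  LinearEquiv.ofLinearMap (Ext1.stablePostₗ R Z X Y e.hom) (Ext1.stablePostₗ R Z Y X e.inv)
    (LinearMap.ext fun δ => by
      rw [LinearMap.comp_apply, Ext1.stablePostₗ_apply, Ext1.stablePostₗ_apply,
        ← Ext1.stablePost_comp, e.inv_hom_id, Ext1.stablePost_id, LinearMap.id_apply])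
    (LinearMap.ext fun δ => by
      rw [LinearMap.comp_apply, Ext1.stablePostₗ_apply, Ext1.stablePostₗ_apply,
        ← Ext1.stablePost_comp, e.hom_inv_id, Ext1.stablePost_id, LinearMap.id_apply])

variable (R) in
/-- An isomorphism of the projectively stable category acts invertibly on `Ext¹`. -/
def stablePreEquiv (X : P.FullSubcategory) {Z Y : ProjStable P} (e : Z ≅ Y) :
    Ext1 Y.as X ≃ₗ[R] Ext1 Z.as X :=
  LinearEquiv.ofLinearMap (Ext1.stablePreₗ R Z Y X e.hom) (Ext1.stablePreₗ R Y Z X e.inv)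
    (LinearMap.ext fun δ => by
      rw [LinearMap.comp_apply, Ext1.stablePreₗ_apply, Ext1.stablePreₗ_apply,
        ← Ext1.stablePre_comp, e.hom_inv_id, Ext1.stablePre_id, LinearMap.id_apply])
    (LinearMap.ext fun δ => by
      rw [LinearMap.comp_apply, Ext1.stablePreₗ_apply, Ext1.stablePreₗ_apply,
        ← Ext1.stablePre_comp, e.inv_hom_id, Ext1.stablePre_id, LinearMap.id_apply])

/-- The action of a fully faithful linear functor on morphisms, as a linear equivalence. -/
noncomputable def mapLinearEquiv {C D : Type*} [Category* C] [Category* D] [Preadditive C]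
    [Preadditive D] [Linear R C] [Linear R D] (F : C ⥤ D) [F.Additive] [F.Linear R] [F.Full]
    [F.Faithful] (X Y : C) : (X ⟶ Y) ≃ₗ[R] (F.obj X ⟶ F.obj Y) :=
  LinearEquiv.ofBijective (F.mapLinearMap R) ⟨F.map_injective, F.map_surjective⟩

lemma IsRightAuslanderReitenFunctor.inv {τ : ProjStable P ⥤ InjStable P}
    (hτ : IsRightAuslanderReitenFunctor P R I τ) [τ.IsEquivalence] :
    IsLeftAuslanderReitenFunctor P R I τ.inv := by
  let e := τ.asEquivalence
  have : e.functor.Additive := hτ.1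
  have : e.functor.Linear R := hτ.linear
  obtain ⟨-, Θ, hΘ, hΘ'⟩ := hτ
  change IsLeftAuslanderReitenFunctor P R I e.inverse
  let η : ∀ X : InjStable P, X ≅ τ.obj (e.inverse.obj X) := fun X => (e.counitIso.app X).symm
  have hη : ∀ {X Y : InjStable P} (f : X ⟶ Y),
      (η X).hom ≫ τ.map (e.inverse.map f) = f ≫ (η Y).hom :=
    fun f => (e.counitInv.naturality f).symm
  refine ⟨inferInstance, fun X Y => ((mapLinearEquiv (R := R) e.inverse X Y).trans (Θ _ _)).trans
    ((stablePostEquiv R _ (η X)).symm.arrowCongr (LinearEquiv.refl R I)), ?_, ?_⟩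
  · intro X' X Y u f δ
    change Θ _ _ (e.inverse.map (u ≫ f)) (Ext1.stablePost (η X').hom δ) =
      Θ _ _ (e.inverse.map f) (Ext1.stablePost (η X).hom (Ext1.stablePost u δ))
    rw [Functor.map_comp, hΘ, ← Ext1.stablePost_comp, ← Ext1.stablePost_comp, hη]
  · intro X Y Y' f v δ
    change Θ _ _ (e.inverse.map (f ≫ v)) (Ext1.stablePost (η X).hom δ) =
      Θ _ _ (e.inverse.map f) (Ext1.stablePost (η X).hom (Ext1.stablePre (e.inverse.map v) δ))
    rw [Functor.map_comp, hΘ', Ext1.stablePost_stablePre]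

lemma IsLeftAuslanderReitenFunctor.inv {τ : InjStable P ⥤ ProjStable P}
    (hτ : IsLeftAuslanderReitenFunctor P R I τ) [τ.IsEquivalence] :
    IsRightAuslanderReitenFunctor P R I τ.inv := by
  let e := τ.asEquivalence
  have : e.functor.Additive := hτ.1
  have : e.functor.Linear R := hτ.linear
  obtain ⟨-, Ω, hΩ, hΩ'⟩ := hτ
  change IsRightAuslanderReitenFunctor P R I e.inverse
  let η : ∀ X : ProjStable P, τ.obj (e.inverse.obj X) ≅ X := fun X => e.counitIso.app X
  have hη : ∀ {X Y : ProjStable P} (f : X ⟶ Y),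
      τ.map (e.inverse.map f) ≫ (η Y).hom = (η X).hom ≫ f := fun f => e.counit.naturality f
  refine ⟨inferInstance, fun X Y => ((mapLinearEquiv (R := R) e.inverse X Y).trans (Ω _ _)).trans
    ((stablePreEquiv R _ (η Y)).symm.arrowCongr (LinearEquiv.refl R I)), ?_, ?_⟩
  · intro X' X Y u f δ
    change Ω _ _ (e.inverse.map (u ≫ f)) (Ext1.stablePre (η Y).hom δ) =
      Ω _ _ (e.inverse.map f) (Ext1.stablePre (η Y).hom (Ext1.stablePost (e.inverse.map u) δ))
    rw [Functor.map_comp, hΩ, Ext1.stablePost_stablePre]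
  · intro X Y Y' f v δ
    change Ω _ _ (e.inverse.map (f ≫ v)) (Ext1.stablePre (η Y').hom δ) =
      Ω _ _ (e.inverse.map f) (Ext1.stablePre (η Y).hom (Ext1.stablePre v δ))
    rw [Functor.map_comp, hΩ', ← Ext1.stablePre_comp, ← Ext1.stablePre_comp, hη]

end Inverse

end TriExact

theorem mainTheorem5
    (R : Type w) [CommRing R]
    (I : Type w) [AddCommGroup I] [Module R I]
    (hI : TriExact.IsMinimalInjectiveCogenerator R I)
    (A : Type u) [Category.{v} A] [HasZeroObject A] [HasShift A ℤ] [Preadditive A]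
    [∀ n : ℤ, (shiftFunctor A n).Additive] [Pretriangulated A] [IsTriangulated A]
    [Linear R A] [∀ n : ℤ, (shiftFunctor A n).Linear R]
    (P : ObjectProperty A) [TriExact.IsExtensionClosed P]
    (hHom : TriExact.IsHomReflexive P R I)
    (hKS : TriExact.IsKrullSchmidt P.FullSubcategory) :
    ((TriExact.HasAlmostSplitSequencesOnTheRight P ↔
        ∃ τ : TriExact.ProjStable P ⥤ TriExact.InjStable P,
          TriExact.IsRightAuslanderReitenFunctor P R I τ ∧ τ.Full) ∧
      (TriExact.HasAlmostSplitSequencesOnTheLeft P ↔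
        ∃ τ : TriExact.InjStable P ⥤ TriExact.ProjStable P,
          TriExact.IsLeftAuslanderReitenFunctor P R I τ ∧ τ.Full)) ∧
    ((TriExact.HasAlmostSplitSequences P ↔
        ∃ τ : TriExact.ProjStable P ⥤ TriExact.InjStable P,
          TriExact.IsRightAuslanderReitenFunctor P R I τ ∧ τ.IsEquivalence) ∧
      (TriExact.HasAlmostSplitSequences P ↔
        ∃ τ : TriExact.InjStable P ⥤ TriExact.ProjStable P,
          TriExact.IsLeftAuslanderReitenFunctor P R I τ ∧ τ.IsEquivalence) ∧
      (TriExact.HasAlmostSplitSequences P → TriExact.IsExtReflexive P R I)) := by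
  have hI := hI.toIsInjectiveCogenerator
  have right_of {τ : TriExact.ProjStable P ⥤ TriExact.InjStable P}
      (hτ : TriExact.IsRightAuslanderReitenFunctor P R I τ) :=
    hτ.hasAlmostSplitSequencesOnTheRight hI hHom hKS
  have left_of {τ : TriExact.InjStable P ⥤ TriExact.ProjStable P}
      (hτ : TriExact.IsLeftAuslanderReitenFunctor P R I τ) :=
    hτ.hasAlmostSplitSequencesOnTheLeft hI hHom hKS
  have equiv_of (h : TriExact.HasAlmostSplitSequences P) :
      ∃ τ : TriExact.ProjStable P ⥤ TriExact.InjStable P,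
        TriExact.IsRightAuslanderReitenFunctor P R I τ ∧ τ.IsEquivalence := by
    choose T φ hφ using TriExact.exists_isARDuality_of_right hI hKS h.1
    have := TriExact.rightARFunctor_essSurj hI hHom hφ
      (TriExact.exists_isARDuality_of_left hI hKS h.2)
    exact ⟨_, TriExact.isRightAuslanderReitenFunctor hI hHom hφ, {}⟩
  refine ⟨⟨⟨fun h => ?_, fun ⟨τ, hτ, _⟩ => right_of hτ⟩,
    ⟨fun h => ?_, fun ⟨τ, hτ, _⟩ => left_of hτ⟩⟩,
    ⟨equiv_of, fun ⟨τ, hτ, _⟩ => ⟨right_of hτ, left_of hτ.inv⟩⟩,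
    ⟨fun h => ?_, fun ⟨τ, hτ, _⟩ => ⟨right_of hτ.inv, left_of hτ⟩⟩, fun h X Y => ?_⟩
  · choose T φ hφ using TriExact.exists_isARDuality_of_right hI hKS h
    exact ⟨_, TriExact.isRightAuslanderReitenFunctor hI hHom hφ, inferInstance⟩
  · choose S φ hφ using TriExact.exists_isARDuality_of_left hI hKS h
    exact ⟨_, TriExact.isLeftAuslanderReitenFunctor hI hHom hφ, inferInstance⟩
  · obtain ⟨τ, hτ, _⟩ := equiv_of h
    exact ⟨τ.inv, hτ.inv, inferInstance⟩
  · obtain ⟨Z, φ, hφ⟩ := TriExact.exists_isARDuality_of_left hI hKS h.2 Y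
    exact hφ.isReflexive_ext1 hI hHom X
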